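/- Let $T>0$ and $d,m,p\in\mathbb N$. Let $f_0:\mathbb R^d\to\mathbb R^d$, $f:\mathbb R^d\to\mathbb R^{d\times m}$ and $c:\mathbb R^d\to\mathbb R^p$ be locally Lipschitz continuous, i.e. Lipschitz continuous on every ball $\{x:\|x\|\le R\}$, $R>0$. Assume that there is a constant $\mathcal C$ such that \[ 2\langle x,f_0(x)\rangle+\|f(x)\|_F^2\le \mathcal C\,(1+\|x\|^2)\qquad\text{for all }x\in\mathbb R^d , \] where $\|\cdot\|_F$ is the Frobenius norm, and let $x_0\in\mathbb R^d$. Then for every $u\in L^2([0,T];\mathbb R^m)$ the equation \[ \dot x(t)=f_0(x(t))+f(x(t))u(t),\qquad x(0)=x_0, \] has a unique (absolutely continuous) solution $x(\cdot\,;u)$ on $[0,T]$. Put $y(t;u)=c(x(t;u))$, with components $y_1,\dots,y_p$, and $\hat U(t)=\bigl(t,\int_0^t u(s)^\top\,\mathrm ds\bigr)^\top\in\mathbb R^{m+1}$ for $t\in[0,T]$. Let $S_{0,t}(\hat U)=\bigl(1,\hat U^{(1)}_{0,t},\hat U^{(2)}_{0,t},\dots\bigr)\in\prod_{k=0}^\infty\mathbb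 R^{(m+1)^k}$ be the signature of $\hat U$ over $[0,t]$, which consists of the iterated Stieltjes integrals \[ \hat U^{(k)}_{0,t}=\int_{0<s_1<\dots<s_k<t}\mathrm d\hat U(s_1)\otimes\dots\otimes\mathrm d\hat U(s_k), \] and let $\mathcal W_{m+1}=\bigoplus_{k=0}^\infty\mathbb R^{(m+1)^k}$, whose elements have only finitely many nonzero entries and are paired with signatures by the Euclidean inner product $\langle\cdot,\cdot\rangle$. Then for every compact set $\mathcal K\subset L^2([0,T];\mathbb R^m)$, every $i\in\{1,\dots,p\}$ and every $\varepsilon>0$ there exists an $\ell_i\in\mathcal W_{m+1}$ (independent of $t$ and $u$) such that \[ \sup_{t\in[0,T]}\,\sup_{u\in\mathcal K}\bigl|y_i(t;u)-\langle\ell_i,S_{0,t}(\hat U)\rangle\bigr|<\varepsilon . \] -/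

import Mathlib

open MeasureTheory Set
open scoped ENNReal Matrix Matrix.Norms.Frobenius

namespace SigApprox

/-- Local Lipschitz continuity: a Lipschitz bound on every ball around the origin. -/
def IsLocallyLipschitz {E F : Type*} [NormedAddCommGroup E] [NormedAddCommGroup F]
    (g : E → F) : Prop :=
  ∀ R : ℝ, 0 < R → ∃ L : ℝ, 0 < L ∧
    ∀ x z : E, ‖x‖ ≤ R → ‖z‖ ≤ R → ‖g x - g z‖ ≤ L * ‖x - z‖

/-- The space `L²([0,T]; ℝᵐ)` of controls. -/
abbrev Control (m : ℕ) (T : ℝ) : Type :=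
  Lp (EuclideanSpace ℝ (Fin m)) 2 (volume.restrict (Icc (0 : ℝ) T))

/-- The right-hand side `f₀(x) + f(x) v` of the controlled equation, with state `x` and
control value `v`. -/
noncomputable def vectorField {d m : ℕ}
    (f₀ : EuclideanSpace ℝ (Fin d) → EuclideanSpace ℝ (Fin d))
    (f : EuclideanSpace ℝ (Fin d) → Matrix (Fin d) (Fin m) ℝ)
    (x : EuclideanSpace ℝ (Fin d)) (v : EuclideanSpace ℝ (Fin m)) :
    EuclideanSpace ℝ (Fin d) :=
  f₀ x + WithLp.toLp 2 (f x *ᵥ v.ofLp)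

/-- `x` is a (Carathéodory) solution on `[0,T]` of
`x' = f₀(x) + f(x) u`, `x(0) = x₀`: it is continuous on `[0,T]` and satisfies the integral form of
the equation there. Values of `x` outside `[0,T]` are irrelevant. -/
structure IsSolution {d m : ℕ} (T : ℝ)
    (f₀ : EuclideanSpace ℝ (Fin d) → EuclideanSpace ℝ (Fin d))
    (f : EuclideanSpace ℝ (Fin d) → Matrix (Fin d) (Fin m) ℝ)
    (x₀ : EuclideanSpace ℝ (Fin d))
    (u : ℝ → EuclideanSpace ℝ (Fin m)) (x : ℝ → EuclideanSpace ℝ (Fin d)) : Prop where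
  continuousOn : ContinuousOn x (Icc 0 T)
  integrableOn : IntegrableOn (fun s => vectorField f₀ f (x s) (u s)) (Icc 0 T)
  eq_integral : ∀ t ∈ Icc (0 : ℝ) T,
    x t = x₀ + ∫ s in (0 : ℝ)..t, vectorField f₀ f (x s) (u s)

/-- `I` is the Riemann–Stieltjes integral of `g` against `X` over `[a,b]`: the limit of the tagged
sums `∑ g(ξₖ) (X(tₖ₊₁) - X(tₖ))` as the mesh of the partition
`a = t₀ ≤ t₁ ≤ ⋯ ≤ tₙ = b` tends to zero. -/
def HasStieltjesIntegral (g X : ℝ → ℝ) (a b I : ℝ) : Prop :=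
  a ≤ b ∧ ∀ ε : ℝ, 0 < ε → ∃ δ : ℝ, 0 < δ ∧
    ∀ (n : ℕ) (t ξ : ℕ → ℝ), t 0 = a → t n = b →
      (∀ k < n, t k ≤ ξ k ∧ ξ k ≤ t (k + 1) ∧ t (k + 1) - t k < δ) →
      |(∑ k ∈ Finset.range n, g (ξ k) * (X (t (k + 1)) - X (t k))) - I| < ε

open Classical in
/-- The Riemann–Stieltjes integral `∫ₐᵇ g dX` (zero if it does not exist). -/
noncomputable def stieltjesIntegral (g X : ℝ → ℝ) (a b : ℝ) : ℝ :=
  if h : ∃ I, HasStieltjesIntegral g X a b I then h.choose else 0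

/-- The coordinate with multi-index `w = (i₁, …, iₖ)` of the `k`-th iterated integral
`∫_{a<s₁<⋯<sₖ<b} dX(s₁) ⊗ ⋯ ⊗ dX(sₖ) ∈ ℝ^{nᵏ}` of an `ℝⁿ`-valued path `X`, i.e.
`∫_{a<s₁<⋯<sₖ<b} dX_{i₁}(s₁) ⋯ dX_{iₖ}(sₖ)`. -/
noncomputable def iteratedIntegral {n : ℕ} (X : ℝ → Fin n → ℝ) (a : ℝ) :
    (k : ℕ) → (Fin k → Fin n) → ℝ → ℝ
  | 0, _, _ => 1
  | k + 1, w, b =>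
      stieltjesIntegral (fun s => iteratedIntegral X a k (Fin.init w) s)
        (fun s => X s (w (Fin.last k))) a b

/-- The signature `S_{a,b}(X) ∈ ∏ₖ ℝ^{nᵏ}`; the coordinates of `ℝ^{nᵏ}` are indexed by the
multi-indices `Fin k → Fin n`. -/
noncomputable def signature {n : ℕ} (X : ℝ → Fin n → ℝ) (a b : ℝ) :
    (k : ℕ) → (Fin k → Fin n) → ℝ :=
  fun k w => iteratedIntegral X a k w b

/-- The space `𝓦ₙ = ⨁ₖ ℝ^{nᵏ}` of families of coordinates of which only finitely many are
nonzero. -/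
abbrev Weights (n : ℕ) : Type := (Σ k : ℕ, Fin k → Fin n) →₀ ℝ

/-- The pairing `⟨ℓ, S⟩` of `ℓ ∈ ⨁ₖ ℝ^{nᵏ}` with `S ∈ ∏ₖ ℝ^{nᵏ}`. -/
noncomputable def pairing {n : ℕ} (l : Weights n) (S : (k : ℕ) → (Fin k → Fin n) → ℝ) : ℝ :=
  l.sum fun w a => a * S w.1 w.2

/-- The time-extended integrated control `Û(t) = (t, ∫₀ᵗ u(s) ds) ∈ ℝ^{m+1}`. -/
noncomputable def timeExtended {m : ℕ} (u : ℝ → EuclideanSpace ℝ (Fin m)) :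
    ℝ → Fin (m + 1) → ℝ :=
  fun t => Fin.cons t (∫ s in (0 : ℝ)..t, u s).ofLp

end SigApprox

/-! The output $(t,u)\mapsto y_i(t;u)$ is a continuous function on the compact space
$[0,T]\times\mathcal K$, and the proof is Stone–Weierstrass for the linear functionals of the
signature.

These functionals form an algebra by integration by parts
(`isSignatureFunctional_iteratedIntegral_mul`). The algebra does not separate points: $S_{0,t}(\hat
U)$ only sees $u$ on $[0,t]$. But neither does $y$. The algebra contains $t$ and the moments
$\int_0^t s^n u_j(s)\,ds$; equal values of these force equal times and controls that agree a.e. on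
$(0,t)$ (`ae_eq_of_moments_eq`), hence equal states by uniqueness (`IsSolution.eqOn`). So $y_i$ is
constant on the fibres of the algebra, which suffices (`exists_mem_subalgebra_norm_sub_lt`).

Continuity of $y$ needs bounds uniform over $\mathcal K$. The growth condition and Grönwall bound
$\|x\|$ in terms of $\|u\|_{L^2}$ (`IsSolution.one_add_norm_sq_le`); on the resulting ball the
coefficients are Lipschitz, and Grönwall again gives continuity in $u$ (`IsSolution.norm_sub_le`).
The same a priori bound yields existence: truncate the coefficients outside a large ball and apply
Picard iteration. -/

namespace SigApprox

/-! ### Calculus for primitives of integrable functions, and Grönwall's inequality. -/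

section Primitives

/-- Postcomposition with a Lipschitz function preserves absolute continuity. -/
theorem absolutelyContinuousOnInterval_comp {F φ : ℝ → ℝ} {a b : ℝ} {C : NNReal} {s : Set ℝ}
    (hφ : LipschitzOnWith C φ s) (hF : AbsolutelyContinuousOnInterval F a b)
    (hs : ∀ x ∈ uIcc a b, F x ∈ s) :
    AbsolutelyContinuousOnInterval (fun x => φ (F x)) a b := by
  rw [absolutelyContinuousOnInterval_iff] at hF ⊢
  intro ε hε
  obtain ⟨δ, hδ, h⟩ := hF (ε / (C + 1)) (by positivity)
  refine ⟨δ, hδ, fun E hE hlt => ?_⟩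
  have h1 := h E hE hlt
  have h2 : ∑ i ∈ Finset.range E.1, dist (φ (F (E.2 i).1)) (φ (F (E.2 i).2)) ≤
      ∑ i ∈ Finset.range E.1, C * dist (F (E.2 i).1) (F (E.2 i).2) := by
    refine Finset.sum_le_sum fun i hi => ?_
    have := hE.1 i hi
    exact hφ.dist_le_mul _ (hs _ this.1) _ (hs _ this.2)
  rw [← Finset.mul_sum] at h2
  have hC : (0 : ℝ) ≤ C := C.2
  rw [lt_div_iff₀ (by positivity)] at h1
  have h3 : 0 ≤ ∑ i ∈ Finset.range E.1, dist (F (E.2 i).1) (F (E.2 i).2) :=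
    Finset.sum_nonneg fun _ _ => dist_nonneg
  nlinarith

/-- Fundamental theorem of calculus for an absolutely continuous function whose derivative is
known almost everywhere. -/
theorem integral_eq_sub_of_ae_hasDerivAt {F F' : ℝ → ℝ} {a b : ℝ}
    (hF : AbsolutelyContinuousOnInterval F a b)
    (hd : ∀ᵐ x, x ∈ uIcc a b → HasDerivAt F (F' x) x) :
    ∫ x in a..b, F' x = F b - F a := by
  rw [← hF.integral_deriv_eq_sub]
  refine intervalIntegral.integral_congr_ae ?_
  filter_upwards [hd] with x hx hxm
  exact (hx (uIoc_subset_uIcc hxm)).deriv.symm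

theorem intervalIntegrable_of_integrableOn_Icc {E : Type*} [NormedAddCommGroup E]
    {g : ℝ → E} {T s t : ℝ} (hg : IntegrableOn g (Icc 0 T))
    (hs : s ∈ Icc 0 T) (ht : t ∈ Icc 0 T) : IntervalIntegrable g volume s t := by
  rw [intervalIntegrable_iff]
  exact hg.mono_set (uIoc_subset_uIcc.trans (uIcc_subset_Icc hs ht))

theorem absolutelyContinuousOnInterval_primitive {g : ℝ → ℝ} {t : ℝ} (c : ℝ)
    (hg : IntervalIntegrable g volume 0 t) :
    AbsolutelyContinuousOnInterval (fun x => c + ∫ s in (0 : ℝ)..x, g s) 0 t := by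
  have h1 := hg.absolutelyContinuousOnInterval_intervalIntegral (c := 0) (by simp)
  have h2 : AbsolutelyContinuousOnInterval (fun _ : ℝ => c) 0 t :=
    ((LipschitzWith.const c).lipschitzOnWith (s := uIcc 0 t)).absolutelyContinuousOnInterval
  exact h2.add h1

theorem ae_hasDerivAt_primitive {g : ℝ → ℝ} {t : ℝ} (c : ℝ)
    (hg : IntervalIntegrable g volume 0 t) :
    ∀ᵐ x, x ∈ uIcc 0 t → HasDerivAt (fun x => c + ∫ s in (0 : ℝ)..x, g s) (g x) x := by
  filter_upwards [hg.ae_hasDerivAt_integral] with x hx hxm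
  exact (hx hxm 0 (by simp)).const_add c

/-- Product rule for primitives of integrable functions. -/
theorem primitive_mul_primitive {g h : ℝ → ℝ} {t : ℝ} (a b : ℝ)
    (hg : IntervalIntegrable g volume 0 t) (hh : IntervalIntegrable h volume 0 t) :
    (a + ∫ s in (0 : ℝ)..t, g s) * (b + ∫ s in (0 : ℝ)..t, h s) =
      a * b + ∫ s in (0 : ℝ)..t, (g s * (b + ∫ r in (0 : ℝ)..s, h r) +
        (a + ∫ r in (0 : ℝ)..s, g r) * h s) := by
  have h1 := absolutelyContinuousOnInterval_primitive a hg
  have h2 := absolutelyContinuousOnInterval_primitive b hh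
  have := integral_eq_sub_of_ae_hasDerivAt (h1.fun_mul h2)
    (F' := fun s => g s * (b + ∫ r in (0 : ℝ)..s, h r) + (a + ∫ r in (0 : ℝ)..s, g r) * h s) (by
      filter_upwards [ae_hasDerivAt_primitive a hg, ae_hasDerivAt_primitive b hh] with x hx hy hxm
      exact (hx hxm).mul (hy hxm))
  rw [this]
  simp

theorem continuousOn_primitive_Icc {E : Type*} [NormedAddCommGroup E] [NormedSpace ℝ E]
    {g : ℝ → E} {T : ℝ} (hT : 0 ≤ T) (hg : IntegrableOn g (Icc 0 T)) :
    ContinuousOn (fun t => ∫ s in (0 : ℝ)..t, g s) (Icc 0 T) := by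
  have := intervalIntegral.continuousOn_primitive_interval (μ := volume) (f := g)
    (a := 0) (b := T) (by rwa [uIcc_of_le hT])
  rwa [uIcc_of_le hT] at this

/-- Powers of a primitive: `∫₀ᵗ K^n k = K(t)^(n+1)/(n+1)`. -/
theorem integral_primitive_pow_mul {k : ℝ → ℝ} {t : ℝ} (hk : IntervalIntegrable k volume 0 t)
    (n : ℕ) :
    ∫ s in (0 : ℝ)..t, (∫ r in (0 : ℝ)..s, k r) ^ n * k s =
      (∫ r in (0 : ℝ)..t, k r) ^ (n + 1) / (n + 1) := by
  have hK := absolutelyContinuousOnInterval_primitive 0 hk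
  simp only [zero_add] at hK
  have hpow : ∀ n : ℕ,
      AbsolutelyContinuousOnInterval (fun x => (∫ s in (0 : ℝ)..x, k s) ^ (n + 1)) 0 t := by
    intro n
    induction n with
    | zero => simpa using hK
    | succ n ih => simpa only [pow_succ _ (n + 1)] using ih.fun_mul hK
  have := integral_eq_sub_of_ae_hasDerivAt (hpow n)
    (F' := fun s => (n + 1) * ((∫ r in (0 : ℝ)..s, k r) ^ n * k s)) (by
      filter_upwards [ae_hasDerivAt_primitive 0 hk] with x hx hxm
      have h1 : HasDerivAt (fun x => ∫ s in (0 : ℝ)..x, k s) (k x) x := by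
        simpa only [zero_add] using hx hxm
      refine (h1.pow (n + 1)).congr_deriv ?_
      simp only [Nat.add_sub_cancel, Nat.cast_add, Nat.cast_one]
      ring)
  rw [intervalIntegral.integral_const_mul] at this
  have hn : (n + 1 : ℝ) ≠ 0 := by positivity
  field_simp
  rw [mul_comm, this]
  simp

/-- Grönwall's inequality with an integrable kernel. -/
theorem gronwall_integrable {k a : ℝ → ℝ} {A T : ℝ} (hT : 0 ≤ T)
    (hk : IntegrableOn k (Icc 0 T)) (hk0 : ∀ s ∈ Icc 0 T, 0 ≤ k s)
    (ha : ContinuousOn a (Icc 0 T))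
    (hle : ∀ t ∈ Icc 0 T, a t ≤ A + ∫ s in (0 : ℝ)..t, k s * a s) :
    ∀ t ∈ Icc 0 T, a t ≤ A * Real.exp (∫ s in (0 : ℝ)..t, k s) := by
  intro t ht
  have h0 : (0 : ℝ) ∈ Icc 0 T := ⟨le_rfl, hT⟩
  have hsub : uIcc 0 t ⊆ Icc 0 T := uIcc_subset_Icc h0 ht
  have hki : IntervalIntegrable k volume 0 t := intervalIntegrable_of_integrableOn_Icc hk h0 ht
  have hkai : IntervalIntegrable (fun s => k s * a s) volume 0 t :=
    hki.mul_continuousOn (ha.mono hsub)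
  have hK := absolutelyContinuousOnInterval_primitive 0 hki
  simp only [zero_add] at hK
  obtain ⟨M, hM⟩ := hK.exists_bound
  have hKneg := hK.neg
  -- `Real.exp` is not globally Lipschitz, but the kernel's primitive only takes values in $[-M,M]$.
  have hexpL : ∃ C : NNReal, LipschitzOnWith C Real.exp (Icc (-M) M) := by
    refine ⟨(Real.exp M).toNNReal, ?_⟩
    refine Convex.lipschitzOnWith_of_nnnorm_deriv_le
      (fun x _ => Real.differentiableAt_exp) (fun x hx => ?_) (convex_Icc _ _)
    rw [← NNReal.coe_le_coe, Real.coe_toNNReal _ (Real.exp_pos _).le]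
    simpa [Real.abs_exp] using hx.2
  obtain ⟨C, hC⟩ := hexpL
  have hE := absolutelyContinuousOnInterval_comp hC hKneg (fun x hx => by
    have := hM x hx
    rw [Real.norm_eq_abs, abs_le] at this
    simp only [Pi.neg_apply, mem_Icc]
    constructor <;> linarith [this.1, this.2])
  have hF := absolutelyContinuousOnInterval_primitive A hkai
  -- With $K=\int k$, the function $(A+\int k a)e^{-K}$ has a.e. derivative $k\,(a-(A+\int k
  -- a))\,e^{-K}\le 0$. Absolute continuity turns this a.e. sign into a decrease.
  have hd := integral_eq_sub_of_ae_hasDerivAt (hF.fun_mul hE)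
    (F' := fun s => k s * (a s - (A + ∫ r in (0 : ℝ)..s, k r * a r)) *
      Real.exp (-∫ r in (0 : ℝ)..s, k r)) (by
      filter_upwards [ae_hasDerivAt_primitive A hkai, ae_hasDerivAt_primitive 0 hki]
        with x hx hy hxm
      have h1 := hx hxm
      have h2 := hy hxm
      simp only [zero_add] at h2
      refine (h1.mul h2.neg.exp).congr_deriv ?_
      simp only [Pi.neg_apply]
      ring)
  have hneg : ∫ s in (0 : ℝ)..t, k s * (a s - (A + ∫ r in (0 : ℝ)..s, k r * a r)) *
      Real.exp (-∫ r in (0 : ℝ)..s, k r) ≤ 0 := by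
    have : 0 ≤ ∫ s in (0 : ℝ)..t, -(k s * (a s - (A + ∫ r in (0 : ℝ)..s, k r * a r)) *
      Real.exp (-∫ r in (0 : ℝ)..s, k r)) := by
      refine intervalIntegral.integral_nonneg ht.1 fun s hs => ?_
      have hs' : s ∈ Icc 0 T := ⟨hs.1, hs.2.trans ht.2⟩
      have h1 := hle s hs'
      have h2 : 0 ≤ k s * ((A + ∫ r in (0 : ℝ)..s, k r * a r) - a s) *
        Real.exp (-∫ r in (0 : ℝ)..s, k r) :=
        mul_nonneg (mul_nonneg (hk0 s hs') (by linarith)) (Real.exp_pos _).le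
      linarith
    rw [intervalIntegral.integral_neg] at this
    linarith
  rw [hd] at hneg
  simp only [Pi.neg_apply, intervalIntegral.integral_same, add_zero, neg_zero, Real.exp_zero,
    mul_one] at hneg
  refine (hle t ht).trans ?_
  rw [Real.exp_neg] at hneg
  have hpos := Real.exp_pos (∫ s in (0 : ℝ)..t, k s)
  have : (A + ∫ s in (0 : ℝ)..t, k s * a s) * (Real.exp (∫ s in (0 : ℝ)..t, k s))⁻¹ ≤ A := by
    linarith
  rwa [← div_eq_mul_inv, div_le_iff₀ hpos] at this

end Primitives

/-! ### The controlled equation: estimates on the vector field. -/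

section ControlledEquation

variable {d m : ℕ}
  {f₀ : EuclideanSpace ℝ (Fin d) → EuclideanSpace ℝ (Fin d)}
  {f : EuclideanSpace ℝ (Fin d) → Matrix (Fin d) (Fin m) ℝ}
  {x₀ : EuclideanSpace ℝ (Fin d)}

/-- Submultiplicativity of the Frobenius norm, with the vector viewed as a one-column matrix. -/
theorem norm_toLp_mulVec_le (M : Matrix (Fin d) (Fin m) ℝ) (v : EuclideanSpace ℝ (Fin m)) :
    ‖(WithLp.toLp 2 (M *ᵥ v.ofLp) : EuclideanSpace ℝ (Fin d))‖ ≤ ‖M‖ * ‖v‖ := by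
  have h := Matrix.frobenius_norm_mul M (Matrix.replicateCol Unit v.ofLp)
  rw [← Matrix.replicateCol_mulVec, Matrix.frobenius_norm_replicateCol,
    Matrix.frobenius_norm_replicateCol] at h
  exact h

theorem IsLocallyLipschitz.continuous {E F : Type*} [NormedAddCommGroup E] [NormedAddCommGroup F]
    {g : E → F} (hg : IsLocallyLipschitz g) : Continuous g := by
  rw [continuous_iff_continuousAt]
  intro x
  obtain ⟨L, hL, h⟩ := hg (‖x‖ + 1) (by positivity)
  have hball : Metric.ball x 1 ∈ nhds x := Metric.ball_mem_nhds x one_pos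
  have hlip : LipschitzOnWith ⟨L, hL.le⟩ g (Metric.ball x 1) := by
    refine LipschitzOnWith.of_dist_le_mul fun y hy z hz => ?_
    have key : ∀ y ∈ Metric.ball x 1, ‖y‖ ≤ ‖x‖ + 1 := by
      intro y hy
      rw [Metric.mem_ball, dist_eq_norm] at hy
      have := norm_sub_norm_le y x
      linarith
    rw [dist_eq_norm, dist_eq_norm]
    exact h y z (key y hy) (key z hz)
  exact hlip.continuousOn.continuousAt hball

theorem continuous_vectorField (hf₀ : Continuous f₀) (hf : Continuous f) :
    Continuous fun p : EuclideanSpace ℝ (Fin d) × EuclideanSpace ℝ (Fin m) =>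
      vectorField f₀ f p.1 p.2 := by
  unfold vectorField
  refine (hf₀.comp continuous_fst).add ?_
  refine (PiLp.continuous_toLp 2 _).comp ?_
  exact (hf.comp continuous_fst).matrix_mulVec
    ((PiLp.continuous_ofLp 2 _).comp continuous_snd)

theorem norm_vectorField_le (x : EuclideanSpace ℝ (Fin d)) (v : EuclideanSpace ℝ (Fin m)) :
    ‖vectorField f₀ f x v‖ ≤ ‖f₀ x‖ + ‖f x‖ * ‖v‖ :=
  (norm_add_le _ _).trans (by gcongr; exact norm_toLp_mulVec_le _ _)

/-- The splitting is asymmetric so that the Grönwall kernel for two solutions involves only the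
control `v`, while `w` enters through `v - w` alone. -/
theorem norm_vectorField_sub_le (x z : EuclideanSpace ℝ (Fin d))
    (v w : EuclideanSpace ℝ (Fin m)) :
    ‖vectorField f₀ f x v - vectorField f₀ f z w‖ ≤
      ‖f₀ x - f₀ z‖ + ‖f x - f z‖ * ‖v‖ + ‖f z‖ * ‖v - w‖ := by
  have h : vectorField f₀ f x v - vectorField f₀ f z w = (f₀ x - f₀ z) +
      WithLp.toLp 2 ((f x - f z) *ᵥ v.ofLp) + WithLp.toLp 2 (f z *ᵥ (v - w).ofLp) := by
    unfold vectorField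
    simp only [Matrix.sub_mulVec, WithLp.ofLp_sub, Matrix.mulVec_sub, WithLp.toLp_sub]
    abel
  rw [h]
  refine (norm_add_le _ _).trans (add_le_add ((norm_add_le _ _).trans (add_le_add le_rfl ?_)) ?_)
  · exact norm_toLp_mulVec_le _ _
  · exact norm_toLp_mulVec_le _ _

theorem integrableOn_vectorField {T : ℝ} (hf₀ : Continuous f₀) (hf : Continuous f)
    {x : ℝ → EuclideanSpace ℝ (Fin d)} {u : ℝ → EuclideanSpace ℝ (Fin m)}
    (hx : ContinuousOn x (Icc 0 T)) (hu : IntegrableOn u (Icc 0 T)) :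
    IntegrableOn (fun s => vectorField f₀ f (x s) (u s)) (Icc 0 T) := by
  have hmeas : AEStronglyMeasurable (fun s => vectorField f₀ f (x s) (u s))
      (volume.restrict (Icc 0 T)) :=
    (continuous_vectorField hf₀ hf).comp_aestronglyMeasurable
      ((hx.aestronglyMeasurable measurableSet_Icc).prodMk hu.aestronglyMeasurable)
  obtain ⟨A, hA⟩ := isCompact_Icc.exists_bound_of_continuousOn (hf₀.comp_continuousOn hx)
  obtain ⟨B, hB⟩ := isCompact_Icc.exists_bound_of_continuousOn (hf.comp_continuousOn hx)
  have hg : IntegrableOn (fun s => A + B * ‖u s‖) (Icc 0 T) :=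
    (integrableOn_const (by simp)).add (hu.norm.const_mul B)
  refine Integrable.mono' hg hmeas ?_
  filter_upwards [ae_restrict_mem measurableSet_Icc] with s hs
  exact (norm_vectorField_le _ _).trans
    (add_le_add (hA s hs) (mul_le_mul_of_nonneg_right (hB s hs) (norm_nonneg _)))

theorem IsSolution.mono {T τ : ℝ} {u : ℝ → EuclideanSpace ℝ (Fin m)}
    {x : ℝ → EuclideanSpace ℝ (Fin d)} (h : IsSolution T f₀ f x₀ u x) (hτ : τ ≤ T) :
    IsSolution τ f₀ f x₀ u x where
  continuousOn := h.continuousOn.mono (Icc_subset_Icc_right hτ)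
  integrableOn := h.integrableOn.mono_set (Icc_subset_Icc_right hτ)
  eq_integral t ht := h.eq_integral t ⟨ht.1, ht.2.trans hτ⟩

/-- Radial cutoff, equal to `1` on the ball of radius `R` and to `0` off the ball of radius
`R + 1`. -/
noncomputable def cutoff {E : Type*} [NormedAddCommGroup E] (R : ℝ) (x : E) : ℝ :=
  max 0 (min 1 (R + 1 - ‖x‖))

section Cutoff

variable {E : Type*} [NormedAddCommGroup E]

theorem cutoff_nonneg (R : ℝ) (x : E) : 0 ≤ cutoff R x := le_max_left _ _

theorem cutoff_le_one (R : ℝ) (x : E) : cutoff R x ≤ 1 :=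
  max_le zero_le_one (min_le_left _ _)

theorem cutoff_eq_one {R : ℝ} {x : E} (h : ‖x‖ ≤ R) : cutoff R x = 1 := by
  unfold cutoff
  rw [min_eq_left (by linarith), max_eq_right zero_le_one]

theorem cutoff_eq_zero {R : ℝ} {x : E} (h : R + 1 ≤ ‖x‖) : cutoff R x = 0 := by
  unfold cutoff
  rw [min_eq_right (by linarith), max_eq_left (by linarith)]

theorem abs_cutoff_sub_le (R : ℝ) (x z : E) : |cutoff R x - cutoff R z| ≤ ‖x - z‖ := by
  unfold cutoff
  refine (abs_max_sub_max_le_max _ _ _ _).trans ?_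
  rw [sub_self, abs_zero]
  refine max_le (norm_nonneg _) ((abs_min_sub_min_le_max _ _ _ _).trans ?_)
  rw [sub_self, abs_zero]
  refine max_le (norm_nonneg _) ?_
  have : R + 1 - ‖x‖ - (R + 1 - ‖z‖) = ‖z‖ - ‖x‖ := by ring
  rw [this, norm_sub_rev]
  exact abs_norm_sub_norm_le z x

/-- On the ball of radius `R + 1` this is a product of bounded Lipschitz functions. If one point
lies outside, its cutoff vanishes and the Lipschitz bound on the cutoff alone suffices. -/
theorem exists_norm_cutoff_smul_sub_le {F : Type*} [NormedAddCommGroup F] [NormedSpace ℝ F]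
    {g : E → F} (hg : IsLocallyLipschitz g) {R : ℝ} (hR : 0 < R) :
    ∃ L : ℝ, 0 ≤ L ∧ ∀ x z, ‖cutoff R x • g x - cutoff R z • g z‖ ≤ L * ‖x - z‖ := by
  obtain ⟨L, hL, h⟩ := hg (R + 1) (by linarith)
  set B := ‖g 0‖ + L * (R + 1) with hB
  have hB0 : 0 ≤ B := by positivity
  have hbd : ∀ x, ‖x‖ ≤ R + 1 → ‖g x‖ ≤ B := by
    intro x hx
    have h1 := h x 0 hx (by simp; linarith)
    rw [sub_zero] at h1
    have h2 := norm_sub_norm_le (g x) (g 0)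
    have h3 : L * ‖x‖ ≤ L * (R + 1) := by gcongr
    linarith
  have key : ∀ x z, ‖x‖ ≤ R + 1 → ‖cutoff R x • g x - cutoff R z • g z‖ ≤ (L + B) * ‖x - z‖ := by
    intro x z hx
    rcases le_total ‖z‖ (R + 1) with hz | hz
    · have : cutoff R x • g x - cutoff R z • g z =
          (cutoff R x - cutoff R z) • g x + cutoff R z • (g x - g z) := by
        rw [sub_smul, smul_sub]; abel
      rw [this]
      refine (norm_add_le _ _).trans ?_
      rw [norm_smul, norm_smul, Real.norm_eq_abs, Real.norm_eq_abs,
        abs_of_nonneg (cutoff_nonneg R z)]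
      have h1 : |cutoff R x - cutoff R z| * ‖g x‖ ≤ ‖x - z‖ * B :=
        mul_le_mul (abs_cutoff_sub_le R x z) (hbd x hx) (norm_nonneg _) (norm_nonneg _)
      have h2 : cutoff R z * ‖g x - g z‖ ≤ 1 * (L * ‖x - z‖) :=
        mul_le_mul (cutoff_le_one R z) (h x z hx hz) (norm_nonneg _) zero_le_one
      linarith
    · have h1 : |cutoff R x - cutoff R z| * ‖g x‖ ≤ ‖x - z‖ * B :=
        mul_le_mul (abs_cutoff_sub_le R x z) (hbd x hx) (norm_nonneg _) (norm_nonneg _)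
      rw [cutoff_eq_zero hz, sub_zero] at h1
      rw [cutoff_eq_zero hz, zero_smul, sub_zero, norm_smul, Real.norm_eq_abs]
      have : 0 ≤ L * ‖x - z‖ := by positivity
      linarith
  refine ⟨L + B, by positivity, fun x z => ?_⟩
  rcases le_total ‖x‖ (R + 1) with hx | hx
  · exact key x z hx
  rcases le_total ‖z‖ (R + 1) with hz | hz
  · rw [norm_sub_rev, norm_sub_rev x z]
    exact key z x hz
  · rw [cutoff_eq_zero hx, cutoff_eq_zero hz]
    simp only [zero_smul, sub_zero, norm_zero]
    positivity

end Cutoff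

/-! ### Existence for globally Lipschitz coefficients. -/

/-- The Picard operator `x ↦ x₀ + ∫₀ᵗ (f₀(x(s)) + f(x(s)) u(s)) ds`. -/
noncomputable def picardOperator {T : ℝ} (hT : 0 ≤ T) (hf₀ : Continuous f₀) (hf : Continuous f)
    (x₀ : EuclideanSpace ℝ (Fin d)) {u : ℝ → EuclideanSpace ℝ (Fin m)}
    (hu : IntegrableOn u (Icc 0 T)) (x : C(Icc 0 T, EuclideanSpace ℝ (Fin d))) :
    C(Icc 0 T, EuclideanSpace ℝ (Fin d)) where
  toFun t := x₀ + ∫ s in (0 : ℝ)..t, vectorField f₀ f (IccExtend hT x s) (u s)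
  continuous_toFun := by
    have h := integrableOn_vectorField hf₀ hf (x.continuous.Icc_extend' (h := hT)).continuousOn hu
    exact continuous_const.add
      (continuousOn_iff_continuous_domRestrict.1 (continuousOn_primitive_Icc hT h))

/-- Each iteration integrates $K^n k$ with $k=L(1+\|u\|)$ and $K=\int k$, which produces the
factorial. Some iterate is therefore a contraction on all of $[0,T]$, with no gluing of short
intervals. -/
theorem norm_picardOperator_iterate_sub_le {T L : ℝ} (hT : 0 ≤ T) (hf₀ : Continuous f₀)
    (hf : Continuous f) {u : ℝ → EuclideanSpace ℝ (Fin m)}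
    (hu : IntegrableOn u (Icc 0 T)) (hL : 0 ≤ L)
    (hL₀ : ∀ x z, ‖f₀ x - f₀ z‖ ≤ L * ‖x - z‖) (hL₁ : ∀ x z, ‖f x - f z‖ ≤ L * ‖x - z‖)
    (x y : C(Icc 0 T, EuclideanSpace ℝ (Fin d))) (n : ℕ) (t : Icc 0 T) :
    ‖(picardOperator hT hf₀ hf x₀ hu)^[n] x t - (picardOperator hT hf₀ hf x₀ hu)^[n] y t‖ ≤
      (∫ s in (0 : ℝ)..t, L * (1 + ‖u s‖)) ^ n / n.factorial * dist x y := by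
  induction n generalizing t with
  | zero => simpa [dist_eq_norm] using ContinuousMap.dist_apply_le_dist (f := x) (g := y) t
  | succ n ih =>
    obtain ⟨t, ht⟩ := t
    have h0 : (0 : ℝ) ∈ Icc 0 T := ⟨le_rfl, hT⟩
    rw [Function.iterate_succ_apply', Function.iterate_succ_apply']
    set X := (picardOperator hT hf₀ hf x₀ hu)^[n] x
    set Y := (picardOperator hT hf₀ hf x₀ hu)^[n] y
    set k : ℝ → ℝ := fun s => L * (1 + ‖u s‖) with hk
    have hkI : IntegrableOn k (Icc 0 T) :=
      ((integrableOn_const (by simp)).add hu.norm).const_mul L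
    have hki := intervalIntegrable_of_integrableOn_Icc hkI h0 ht
    have hXi := intervalIntegrable_of_integrableOn_Icc (integrableOn_vectorField hf₀ hf
      (X.continuous.Icc_extend' (h := hT)).continuousOn hu) h0 ht
    have hYi := intervalIntegrable_of_integrableOn_Icc (integrableOn_vectorField hf₀ hf
      (Y.continuous.Icc_extend' (h := hT)).continuousOn hu) h0 ht
    have hsub : (picardOperator hT hf₀ hf x₀ hu X) ⟨t, ht⟩ -
        (picardOperator hT hf₀ hf x₀ hu Y) ⟨t, ht⟩ =
        ∫ s in (0 : ℝ)..t, (vectorField f₀ f (IccExtend hT X s) (u s) -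
          vectorField f₀ f (IccExtend hT Y s) (u s)) := by
      rw [intervalIntegral.integral_sub hXi hYi]
      simp [picardOperator]
    rw [hsub]
    have hKc : ContinuousOn (fun s => ∫ r in (0 : ℝ)..s, k r) (uIcc 0 t) :=
      (continuousOn_primitive_Icc hT hkI).mono (uIcc_subset_Icc h0 ht)
    have hbi : IntervalIntegrable
        (fun s => dist x y / n.factorial * ((∫ r in (0 : ℝ)..s, k r) ^ n * k s)) volume 0 t :=
      (hki.continuousOn_mul (hKc.pow n)).const_mul _
    refine (intervalIntegral.norm_integral_le_of_norm_le ht.1 ?_ hbi).trans_eq ?_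
    · filter_upwards with s hs
      have hs' : s ∈ Icc 0 T := ⟨hs.1.le, hs.2.trans ht.2⟩
      have h1 := norm_vectorField_sub_le (f₀ := f₀) (f := f) (IccExtend hT X s)
        (IccExtend hT Y s) (u s) (u s)
      rw [sub_self, norm_zero, mul_zero, add_zero] at h1
      rw [IccExtend_of_mem hT X hs', IccExtend_of_mem hT Y hs'] at h1 ⊢
      have h2 := hL₀ (X ⟨s, hs'⟩) (Y ⟨s, hs'⟩)
      have h3 := mul_le_mul_of_nonneg_right (hL₁ (X ⟨s, hs'⟩) (Y ⟨s, hs'⟩)) (norm_nonneg (u s))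
      have h4 := mul_le_mul_of_nonneg_left (ih ⟨s, hs'⟩)
        (mul_nonneg hL (by positivity : 0 ≤ 1 + ‖u s‖))
      calc _ ≤ L * (1 + ‖u s‖) * ‖X ⟨s, hs'⟩ - Y ⟨s, hs'⟩‖ := by linarith
        _ ≤ _ := h4
        _ = _ := by simp only [hk]; ring
    · rw [intervalIntegral.integral_const_mul, integral_primitive_pow_mul hki,
        Nat.factorial_succ]
      push_cast
      have : (n.factorial : ℝ) ≠ 0 := by positivity
      field_simp

theorem exists_isSolution_of_lipschitz {T L : ℝ} (hT : 0 ≤ T)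
    {u : ℝ → EuclideanSpace ℝ (Fin m)}
    (hu : IntegrableOn u (Icc 0 T)) (hL : 0 ≤ L)
    (hL₀ : ∀ x z, ‖f₀ x - f₀ z‖ ≤ L * ‖x - z‖) (hL₁ : ∀ x z, ‖f x - f z‖ ≤ L * ‖x - z‖)
    (x₀ : EuclideanSpace ℝ (Fin d)) :
    ∃ x, IsSolution T f₀ f x₀ u x := by
  have hf₀ : Continuous f₀ := (LipschitzWith.of_dist_le_mul (K := ⟨L, hL⟩) (fun x z => by
    rw [dist_eq_norm, dist_eq_norm]; exact hL₀ x z)).continuous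
  have hf : Continuous f := (LipschitzWith.of_dist_le_mul (K := ⟨L, hL⟩) (fun x z => by
    rw [dist_eq_norm, dist_eq_norm]; exact hL₁ x z)).continuous
  set Φ := picardOperator hT hf₀ hf x₀ hu with hΦ
  set k : ℝ → ℝ := fun s => L * (1 + ‖u s‖) with hk
  have hk0 : ∀ s, 0 ≤ k s := fun s => by positivity
  have hkI : IntegrableOn k (Icc 0 T) :=
    ((integrableOn_const (by simp)).add hu.norm).const_mul L
  obtain ⟨n, hn⟩ := ((FloorSemiring.tendsto_pow_div_factorial_atTop
    (∫ s in (0 : ℝ)..T, k s)).eventually (ge_mem_nhds (by norm_num : (0 : ℝ) < 1 / 2))).exists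
  have hcon : ContractingWith (1 / 2) Φ^[n] := by
    refine ⟨by rw [← NNReal.coe_lt_coe]; norm_num, LipschitzWith.of_dist_le_mul fun x y => ?_⟩
    rw [ContinuousMap.dist_le (by positivity)]
    intro t
    rw [dist_eq_norm]
    refine (norm_picardOperator_iterate_sub_le hT hf₀ hf hu hL hL₀ hL₁ x y n t).trans ?_
    have hmono : ∫ s in (0 : ℝ)..t, k s ≤ ∫ s in (0 : ℝ)..T, k s :=
      intervalIntegral.integral_mono_interval le_rfl t.2.1 t.2.2
        (Filter.Eventually.of_forall hk0)
        (intervalIntegrable_of_integrableOn_Icc hkI ⟨le_rfl, hT⟩ ⟨hT, le_rfl⟩)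
    have hpos : 0 ≤ ∫ s in (0 : ℝ)..t, k s :=
      intervalIntegral.integral_nonneg t.2.1 fun s _ => hk0 s
    have : (∫ s in (0 : ℝ)..t, k s) ^ n / n.factorial ≤ 1 / 2 := by
      refine le_trans ?_ hn
      gcongr
    refine (mul_le_mul_of_nonneg_right this dist_nonneg).trans_eq ?_
    norm_num
  have hne : Nonempty C(Icc 0 T, EuclideanSpace ℝ (Fin d)) := ⟨0⟩
  -- The fixed point of a contracting iterate is fixed by the map itself.
  have hfix := hcon.isFixedPt_fixedPoint_iterate
  set X := ContractingWith.fixedPoint Φ^[n] hcon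
  have hXc : ContinuousOn (IccExtend hT X) (Icc 0 T) :=
    (X.continuous.Icc_extend' (h := hT)).continuousOn
  refine ⟨IccExtend hT X, hXc, integrableOn_vectorField hf₀ hf hXc hu, fun t ht => ?_⟩
  rw [IccExtend_of_mem hT X ht]
  conv_lhs => rw [← hfix.eq]
  rfl

/-! ### A priori bound, stability, uniqueness and existence. -/

/-- By Young, $2\|x\|\|f\|\|v\|\le\|f\|^2+\|x\|^2\|v\|^2$. The growth condition absorbs $\|f\|^2$;
the kernel $C+\|v\|^2$ that remains is integrable for $L^2$ controls. -/
theorem two_inner_vectorField_le {C : ℝ} {x : EuclideanSpace ℝ (Fin d)}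
    (hC : 2 * inner ℝ x (f₀ x) + ‖f x‖ ^ 2 ≤ C * (1 + ‖x‖ ^ 2))
    (v : EuclideanSpace ℝ (Fin m)) :
    2 * inner ℝ x (vectorField f₀ f x v) ≤ (C + ‖v‖ ^ 2) * (1 + ‖x‖ ^ 2) := by
  unfold vectorField
  rw [inner_add_right]
  have h1 := real_inner_le_norm x (WithLp.toLp 2 (f x *ᵥ v.ofLp))
  have h2 := mul_le_mul_of_nonneg_left (norm_toLp_mulVec_le (f x) v) (norm_nonneg x)
  nlinarith [sq_nonneg (‖f x‖ - ‖x‖ * ‖v‖), sq_nonneg ‖v‖]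

theorem IsSolution.norm_sq_eq {T : ℝ} {u : ℝ → EuclideanSpace ℝ (Fin m)}
    {x : ℝ → EuclideanSpace ℝ (Fin d)} (h : IsSolution T f₀ f x₀ u x) {t : ℝ}
    (ht : t ∈ Icc 0 T) :
    ‖x t‖ ^ 2 = ‖x₀‖ ^ 2 +
      ∫ s in (0 : ℝ)..t, 2 * inner ℝ (x s) (vectorField f₀ f (x s) (u s)) := by
  set V := fun s => vectorField f₀ f (x s) (u s) with hV
  have h0 : (0 : ℝ) ∈ Icc 0 T := ⟨le_rfl, ht.1.trans ht.2⟩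
  have hVi : IntervalIntegrable V volume 0 t :=
    intervalIntegrable_of_integrableOn_Icc h.integrableOn h0 ht
  have hVc : ∀ i, IntervalIntegrable (fun s => V s i) volume 0 t := fun i =>
    ((EuclideanSpace.proj i : EuclideanSpace ℝ (Fin d) →L[ℝ] ℝ).integrableOn_comp
      (intervalIntegrable_iff.1 hVi) : _) |> intervalIntegrable_iff.2
  have hcoord : ∀ s ∈ Icc 0 t, ∀ i, x s i = x₀ i + ∫ r in (0 : ℝ)..s, V r i := by
    intro s hs i
    have hs' : s ∈ Icc 0 T := ⟨hs.1, hs.2.trans ht.2⟩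
    have hVs : IntervalIntegrable V volume 0 s :=
      intervalIntegrable_of_integrableOn_Icc h.integrableOn h0 hs'
    have := (EuclideanSpace.proj i : EuclideanSpace ℝ (Fin d) →L[ℝ] ℝ).intervalIntegral_comp_comm
      hVs
    rw [h.eq_integral s hs', PiLp.add_apply]
    congr 1
    exact this.symm
  have hxc : ∀ i, ContinuousOn (fun s => x s i) (uIcc 0 t) := fun i =>
    (EuclideanSpace.proj i : EuclideanSpace ℝ (Fin d) →L[ℝ] ℝ).continuous.comp_continuousOn
      (h.continuousOn.mono (uIcc_subset_Icc h0 ht))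
  have hsq : ∀ i, x t i ^ 2 = x₀ i ^ 2 + ∫ s in (0 : ℝ)..t, 2 * (x s i * V s i) := by
    intro i
    rw [hcoord t ⟨ht.1, le_rfl⟩ i, sq, primitive_mul_primitive _ _ (hVc i) (hVc i), sq]
    congr 1
    refine intervalIntegral.integral_congr fun s hs => ?_
    rw [uIcc_of_le ht.1] at hs
    simp only
    rw [hcoord s hs i]
    ring
  rw [EuclideanSpace.real_norm_sq_eq, EuclideanSpace.real_norm_sq_eq]
  simp only [hsq, Finset.sum_add_distrib]
  rw [← intervalIntegral.integral_finsetSum]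
  · congr 1
    refine intervalIntegral.integral_congr fun s _ => ?_
    simp only [PiLp.inner_apply, hV, Finset.mul_sum]
    refine Finset.sum_congr rfl fun i _ => ?_
    simp [mul_comm]
  · intro i _
    exact ((hVc i).continuousOn_mul (hxc i)).const_mul 2

/-- A priori bound for solutions under one-sided linear growth. -/
theorem IsSolution.one_add_norm_sq_le {T C : ℝ} {u : ℝ → EuclideanSpace ℝ (Fin m)}
    {x : ℝ → EuclideanSpace ℝ (Fin d)} (h : IsSolution T f₀ f x₀ u x) (hT : 0 ≤ T)
    (hC0 : 0 ≤ C)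
    (hC : ∀ x, 2 * inner ℝ x (f₀ x) + ‖f x‖ ^ 2 ≤ C * (1 + ‖x‖ ^ 2))
    (hu : IntegrableOn (fun s => ‖u s‖ ^ 2) (Icc 0 T)) :
    ∀ t ∈ Icc 0 T, 1 + ‖x t‖ ^ 2 ≤
      (1 + ‖x₀‖ ^ 2) * Real.exp (∫ s in (0 : ℝ)..T, (C + ‖u s‖ ^ 2)) := by
  intro t ht
  have h0 : (0 : ℝ) ∈ Icc 0 T := ⟨le_rfl, hT⟩
  have hkI : IntegrableOn (fun s => C + ‖u s‖ ^ 2) (Icc 0 T) :=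
    (integrableOn_const (by simp)).add hu
  have hk0 : ∀ s, 0 ≤ C + ‖u s‖ ^ 2 := fun s => by positivity
  have hac : ContinuousOn (fun t => 1 + ‖x t‖ ^ 2) (Icc 0 T) :=
    continuousOn_const.add (h.continuousOn.norm.pow 2)
  refine (gronwall_integrable hT hkI (fun s _ => hk0 s) hac (A := 1 + ‖x₀‖ ^ 2)
    (fun t ht => ?_) t ht).trans ?_
  · rw [h.norm_sq_eq ht, ← add_assoc]
    gcongr
    have hsub := uIcc_subset_Icc h0 ht
    refine intervalIntegral.integral_mono_on ht.1 ?_ ?_ fun s _ =>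
      two_inner_vectorField_le (hC (x s)) (u s)
    · refine IntervalIntegrable.const_mul ?_ 2
      have hVi := intervalIntegrable_of_integrableOn_Icc h.integrableOn h0 ht
      rw [intervalIntegrable_iff] at hVi ⊢
      have hm : AEStronglyMeasurable x (volume.restrict (uIoc 0 t)) :=
        (h.continuousOn.mono (uIoc_subset_uIcc.trans hsub)).aestronglyMeasurable
          measurableSet_uIoc
      obtain ⟨B, hB⟩ := isCompact_Icc.exists_bound_of_continuousOn h.continuousOn
      refine Integrable.mono' (hVi.norm.const_mul B) (hm.inner hVi.aestronglyMeasurable) ?_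
      filter_upwards [ae_restrict_mem measurableSet_uIoc] with s hs
      exact (norm_inner_le_norm _ _).trans
        (mul_le_mul_of_nonneg_right (hB s (hsub (uIoc_subset_uIcc hs))) (norm_nonneg _))
    · exact (intervalIntegrable_of_integrableOn_Icc hkI h0 ht).mul_continuousOn (hac.mono hsub)
  · gcongr
    exact intervalIntegral.integral_mono_interval le_rfl ht.1 ht.2
      (Filter.Eventually.of_forall hk0)
      (intervalIntegrable_of_integrableOn_Icc hkI h0 ⟨hT, le_rfl⟩)

/-- Stability of bounded solutions with respect to the control. -/
theorem IsSolution.norm_sub_le {T L R F : ℝ} {u v : ℝ → EuclideanSpace ℝ (Fin m)}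
    {x z : ℝ → EuclideanSpace ℝ (Fin d)} (hT : 0 ≤ T)
    (hx : IsSolution T f₀ f x₀ u x) (hz : IsSolution T f₀ f x₀ v z)
    (hu : IntegrableOn u (Icc 0 T)) (hv : IntegrableOn v (Icc 0 T))
    (hxR : ∀ t ∈ Icc 0 T, ‖x t‖ ≤ R) (hzR : ∀ t ∈ Icc 0 T, ‖z t‖ ≤ R) (hL : 0 ≤ L)
    (hL₀ : ∀ x z, ‖x‖ ≤ R → ‖z‖ ≤ R → ‖f₀ x - f₀ z‖ ≤ L * ‖x - z‖)
    (hL₁ : ∀ x z, ‖x‖ ≤ R → ‖z‖ ≤ R → ‖f x - f z‖ ≤ L * ‖x - z‖)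
    (hF0 : 0 ≤ F) (hF : ∀ x, ‖x‖ ≤ R → ‖f x‖ ≤ F) :
    ∀ t ∈ Icc 0 T, ‖x t - z t‖ ≤ F * (∫ s in (0 : ℝ)..T, ‖u s - v s‖) *
      Real.exp (∫ s in (0 : ℝ)..T, L * (1 + ‖u s‖)) := by
  intro t ht
  have h0 : (0 : ℝ) ∈ Icc 0 T := ⟨le_rfl, hT⟩
  have hTT : T ∈ Icc 0 T := ⟨hT, le_rfl⟩
  have hkI : IntegrableOn (fun s => L * (1 + ‖u s‖)) (Icc 0 T) :=
    ((integrableOn_const (by simp)).add hu.norm).const_mul L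
  have hk0 : ∀ s, 0 ≤ L * (1 + ‖u s‖) := fun s => by positivity
  have hac : ContinuousOn (fun t => ‖x t - z t‖) (Icc 0 T) :=
    (hx.continuousOn.sub hz.continuousOn).norm
  have hdI : IntegrableOn (fun s => ‖u s - v s‖) (Icc 0 T) := (hu.sub hv).norm
  refine (gronwall_integrable hT hkI (fun s _ => hk0 s) hac
    (A := F * (∫ s in (0 : ℝ)..T, ‖u s - v s‖)) (fun t ht => ?_) t ht).trans ?_
  · have hsub := uIcc_subset_Icc h0 ht
    have hdt := intervalIntegrable_of_integrableOn_Icc hdI h0 ht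
    have hkt := (intervalIntegrable_of_integrableOn_Icc hkI h0 ht).mul_continuousOn
      (hac.mono hsub)
    have hxi := intervalIntegrable_of_integrableOn_Icc hx.integrableOn h0 ht
    have hzi := intervalIntegrable_of_integrableOn_Icc hz.integrableOn h0 ht
    have heq : x t - z t = ∫ s in (0 : ℝ)..t,
        (vectorField f₀ f (x s) (u s) - vectorField f₀ f (z s) (v s)) := by
      rw [intervalIntegral.integral_sub hxi hzi, hx.eq_integral t ht, hz.eq_integral t ht]
      abel
    have hle : ‖x t - z t‖ ≤ ∫ s in (0 : ℝ)..t,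
        (F * ‖u s - v s‖ + L * (1 + ‖u s‖) * ‖x s - z s‖) := by
      rw [heq]
      refine intervalIntegral.norm_integral_le_of_norm_le ht.1 ?_ ((hdt.const_mul F).add hkt)
      filter_upwards with s hs
      have hs' : s ∈ Icc 0 T := ⟨hs.1.le, hs.2.trans ht.2⟩
      have h1 := norm_vectorField_sub_le (f₀ := f₀) (f := f) (x s) (z s) (u s) (v s)
      have h2 := hL₀ _ _ (hxR s hs') (hzR s hs')
      have h3 := mul_le_mul_of_nonneg_right (hL₁ _ _ (hxR s hs') (hzR s hs')) (norm_nonneg (u s))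
      have h4 := mul_le_mul_of_nonneg_right (hF _ (hzR s hs')) (norm_nonneg (u s - v s))
      linarith
    rw [intervalIntegral.integral_add (hdt.const_mul F) hkt,
      intervalIntegral.integral_const_mul] at hle
    refine hle.trans ?_
    gcongr
    exact intervalIntegral.integral_mono_interval le_rfl ht.1 ht.2
      (Filter.Eventually.of_forall fun s => norm_nonneg _)
      (intervalIntegrable_of_integrableOn_Icc hdI h0 hTT)
  · have : 0 ≤ ∫ s in (0 : ℝ)..T, ‖u s - v s‖ :=
      intervalIntegral.integral_nonneg hT fun s _ => norm_nonneg _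
    gcongr
    exact intervalIntegral.integral_mono_interval le_rfl ht.1 ht.2
      (Filter.Eventually.of_forall hk0)
      (intervalIntegrable_of_integrableOn_Icc hkI h0 hTT)

theorem exists_lipschitz_bounds (hf₀ : IsLocallyLipschitz f₀) (hf : IsLocallyLipschitz f)
    {R : ℝ} (hR : 0 < R) :
    ∃ L F : ℝ, 0 ≤ L ∧ 0 ≤ F ∧
      (∀ x z, ‖x‖ ≤ R → ‖z‖ ≤ R → ‖f₀ x - f₀ z‖ ≤ L * ‖x - z‖) ∧
      (∀ x z, ‖x‖ ≤ R → ‖z‖ ≤ R → ‖f x - f z‖ ≤ L * ‖x - z‖) ∧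
      ∀ x, ‖x‖ ≤ R → ‖f x‖ ≤ F := by
  obtain ⟨L₀, hL₀, h₀⟩ := hf₀ R hR
  obtain ⟨L₁, hL₁, h₁⟩ := hf R hR
  refine ⟨L₀ + L₁, ‖f 0‖ + L₁ * R, by positivity, by positivity, fun x z hx hz => ?_,
    fun x z hx hz => ?_, fun x hx => ?_⟩
  · exact (h₀ x z hx hz).trans (by gcongr; linarith)
  · exact (h₁ x z hx hz).trans (by gcongr; linarith)
  · have h1 := h₁ x 0 hx (by simpa using hR.le)
    rw [sub_zero] at h1
    have h2 := norm_sub_norm_le (f x) (f 0)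
    have h3 : L₁ * ‖x‖ ≤ L₁ * R := by gcongr
    linarith

/-- Solutions for almost everywhere equal controls coincide. -/
theorem IsSolution.eqOn {T : ℝ} {u v : ℝ → EuclideanSpace ℝ (Fin m)}
    {x z : ℝ → EuclideanSpace ℝ (Fin d)} (hT : 0 ≤ T)
    (hf₀ : IsLocallyLipschitz f₀) (hf : IsLocallyLipschitz f)
    (hx : IsSolution T f₀ f x₀ u x) (hz : IsSolution T f₀ f x₀ v z)
    (hu : IntegrableOn u (Icc 0 T)) (hv : IntegrableOn v (Icc 0 T))
    (huv : ∀ᵐ s, s ∈ Ioo 0 T → u s = v s) : EqOn x z (Icc 0 T) := by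
  obtain ⟨A, hA⟩ := isCompact_Icc.exists_bound_of_continuousOn hx.continuousOn
  obtain ⟨B, hB⟩ := isCompact_Icc.exists_bound_of_continuousOn hz.continuousOn
  obtain ⟨L, F, hL, hF, h₀, h₁, h₂⟩ :=
    exists_lipschitz_bounds hf₀ hf (R := |A| + |B| + 1) (by positivity)
  intro t ht
  have hint : ∫ s in (0 : ℝ)..T, ‖u s - v s‖ = 0 := by
    rw [intervalIntegral.integral_of_le hT, integral_Ioc_eq_integral_Ioo]
    rw [setIntegral_congr_ae (g := fun _ => (0 : ℝ)) measurableSet_Ioo]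
    · simp
    · filter_upwards [huv] with s hs hsm
      rw [hs hsm, sub_self, norm_zero]
  have := IsSolution.norm_sub_le hT hx hz hu hv
    (fun t ht => (hA t ht).trans (by linarith [le_abs_self A, abs_nonneg B]))
    (fun t ht => (hB t ht).trans (by linarith [le_abs_self B, abs_nonneg A])) hL h₀ h₁ hF h₂ t ht
  rw [hint, mul_zero, zero_mul] at this
  exact sub_eq_zero.1 (norm_le_zero_iff.1 this)

/-- Truncating both coefficients preserves the growth condition with the same `C`, so the truncated
solution obeys the same a priori bound and never leaves the ball where the cutoff is 1. -/
theorem exists_isSolution {T C : ℝ} (hT : 0 ≤ T) (hC0 : 0 ≤ C)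
    (hf₀ : IsLocallyLipschitz f₀) (hf : IsLocallyLipschitz f)
    (hC : ∀ x, 2 * inner ℝ x (f₀ x) + ‖f x‖ ^ 2 ≤ C * (1 + ‖x‖ ^ 2))
    {u : ℝ → EuclideanSpace ℝ (Fin m)} (hu : IntegrableOn u (Icc 0 T))
    (hu2 : IntegrableOn (fun s => ‖u s‖ ^ 2) (Icc 0 T)) (x₀ : EuclideanSpace ℝ (Fin d)) :
    ∃ x, IsSolution T f₀ f x₀ u x := by
  set Q := (1 + ‖x₀‖ ^ 2) * Real.exp (∫ s in (0 : ℝ)..T, (C + ‖u s‖ ^ 2)) with hQ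
  have hQ0 : 0 < Q := by positivity
  set R := Q + 1 with hR
  obtain ⟨L₀, hL₀, h₀⟩ := exists_norm_cutoff_smul_sub_le hf₀ (R := R) (by positivity)
  obtain ⟨L₁, hL₁, h₁⟩ := exists_norm_cutoff_smul_sub_le hf (R := R) (by positivity)
  obtain ⟨x, hx⟩ := exists_isSolution_of_lipschitz (f₀ := fun x => cutoff R x • f₀ x)
    (f := fun x => cutoff R x • f x) hT hu (add_nonneg hL₀ hL₁)
    (fun x z => (h₀ x z).trans (by gcongr; linarith))
    (fun x z => (h₁ x z).trans (by gcongr; linarith)) x₀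
  have hbd := hx.one_add_norm_sq_le hT hC0 (fun x => by
    have h1 := hC x
    have h2 := cutoff_nonneg R x
    have h3 := cutoff_le_one R x
    rw [inner_smul_right, norm_smul, Real.norm_eq_abs, abs_of_nonneg h2, mul_pow]
    -- Scaling the growth condition by the cutoff $\chi$ leaves $\chi^2\|f\|^2$ to compare with
    -- $\chi\|f\|^2$: use $0\le\chi\le1$. Dropping $\chi$ on the right uses `hC0`.
    have h4 : cutoff R x ^ 2 * ‖f x‖ ^ 2 ≤ cutoff R x * ‖f x‖ ^ 2 := by
      gcongr
      nlinarith
    have h5 := mul_le_mul_of_nonneg_left h1 h2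
    have h6 : cutoff R x * (C * (1 + ‖x‖ ^ 2)) ≤ 1 * (C * (1 + ‖x‖ ^ 2)) := by gcongr
    linarith) hu2
  have hxR : ∀ t ∈ Icc 0 T, ‖x t‖ ≤ R := by
    intro t ht
    have h1 := hbd t ht
    nlinarith [sq_nonneg (‖x t‖ - 1)]
  have hV : ∀ t ∈ Icc 0 T, vectorField (fun x => cutoff R x • f₀ x) (fun x => cutoff R x • f x)
      (x t) (u t) = vectorField f₀ f (x t) (u t) := by
    intro t ht
    simp [vectorField, cutoff_eq_one (hxR t ht)]
  refine ⟨x, hx.continuousOn, hx.integrableOn.congr_fun hV measurableSet_Icc, fun t ht => ?_⟩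
  rw [hx.eq_integral t ht]
  congr 1
  refine intervalIntegral.integral_congr fun s hs => hV s ?_
  exact uIcc_subset_Icc ⟨le_rfl, hT⟩ ht hs

end ControlledEquation

/-! ### Riemann–Stieltjes integrals against absolutely continuous integrators. -/

section Stieltjes

/-- Uniform partitions have arbitrarily small mesh, so the limit is not vacuous. This identifies the
value that `stieltjesIntegral` obtains by choice. -/
theorem HasStieltjesIntegral.unique {g X : ℝ → ℝ} {a b I J : ℝ}
    (hI : HasStieltjesIntegral g X a b I) (hJ : HasStieltjesIntegral g X a b J) : I = J := by
  by_contra hne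
  have hpos : 0 < |I - J| / 2 := by
    have := abs_pos.2 (sub_ne_zero.2 hne)
    positivity
  obtain ⟨δ₁, hδ₁, h₁⟩ := hI.2 _ hpos
  obtain ⟨δ₂, hδ₂, h₂⟩ := hJ.2 _ hpos
  have hab := hI.1
  obtain ⟨n, hn⟩ := exists_nat_gt ((b - a) / min δ₁ δ₂)
  have hδ : 0 < min δ₁ δ₂ := lt_min hδ₁ hδ₂
  have hn0 : (0 : ℝ) < n := lt_of_le_of_lt (div_nonneg (by linarith) hδ.le) hn
  have hmesh : (b - a) / n < min δ₁ δ₂ := by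
    rw [div_lt_iff₀ hδ] at hn
    rw [div_lt_iff₀ hn0]
    linarith
  have hmesh0 : 0 ≤ (b - a) / n := div_nonneg (by linarith) hn0.le
  set t : ℕ → ℝ := fun k => a + k * ((b - a) / n) with ht
  have ht0 : t 0 = a := by simp [ht]
  have htn : t n = b := by simp only [ht]; field_simp; ring
  have hstep : ∀ k, t (k + 1) - t k = (b - a) / n := fun k => by
    simp only [ht]; push_cast; ring
  have h1 := h₁ n t t ht0 htn fun k _ => ⟨le_rfl, by linarith [hstep k],
    by rw [hstep]; exact hmesh.trans_le (min_le_left _ _)⟩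
  have h2 := h₂ n t t ht0 htn fun k _ => ⟨le_rfl, by linarith [hstep k],
    by rw [hstep]; exact hmesh.trans_le (min_le_right _ _)⟩
  rw [abs_sub_comm] at h1
  have h3 := abs_sub_le I (∑ k ∈ Finset.range n, g (t k) * (X (t (k + 1)) - X (t k))) J
  linarith

theorem HasStieltjesIntegral.stieltjesIntegral_eq {g X : ℝ → ℝ} {a b I : ℝ}
    (h : HasStieltjesIntegral g X a b I) : stieltjesIntegral g X a b = I := by
  have hex : ∃ I, HasStieltjesIntegral g X a b I := ⟨I, h⟩
  unfold stieltjesIntegral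
  rw [dif_pos hex]
  exact hex.choose_spec.unique h

/-- The Riemann–Stieltjes integral of a continuous function against a primitive of an integrable
function `v` is the Lebesgue integral against `v`. -/
theorem hasStieltjesIntegral_of_primitive {g X v : ℝ → ℝ} {a b : ℝ} (hab : a ≤ b)
    (hg : ContinuousOn g (Icc a b)) (hv : IntegrableOn v (Icc a b))
    (hX : ∀ s ∈ Icc a b, ∀ t ∈ Icc a b, X t - X s = ∫ r in s..t, v r) :
    HasStieltjesIntegral g X a b (∫ s in a..b, g s * v s) := by
  refine ⟨hab, fun ε hε => ?_⟩
  set A := ∫ s in a..b, |v s| with hA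
  have hA0 : 0 ≤ A := intervalIntegral.integral_nonneg hab fun s _ => abs_nonneg _
  have hη : 0 < ε / (A + 1) := by positivity
  obtain ⟨δ, hδ, hu⟩ := Metric.uniformContinuousOn_iff.1
    (isCompact_Icc.uniformContinuousOn_of_continuous hg) _ hη
  refine ⟨δ, hδ, fun n t ξ ht0 htn hpart => ?_⟩
  have hmono : ∀ k < n, t k ≤ t (k + 1) := fun k hk => (hpart k hk).1.trans (hpart k hk).2.1
  have hadd : ∀ k j, k + j ≤ n → t k ≤ t (k + j) := by
    intro k j
    induction j with
    | zero => intro _; exact le_rfl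
    | succ j ih => intro hj; exact (ih (by omega)).trans (hmono (k + j) (by omega))
  have hge : ∀ k ≤ n, a ≤ t k := fun k hk => by
    simpa [ht0] using hadd 0 k (by omega)
  have hle : ∀ k ≤ n, t k ≤ b := fun k hk => by
    simpa [Nat.add_sub_cancel' hk, htn] using hadd k (n - k) (by omega)
  have hmem : ∀ k ≤ n, t k ∈ Icc a b := fun k hk => ⟨hge k hk, hle k hk⟩
  have hvi : ∀ s ∈ Icc a b, ∀ t ∈ Icc a b, IntervalIntegrable v volume s t := by
    intro s hs t ht
    rw [intervalIntegrable_iff]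
    exact hv.mono_set (uIoc_subset_uIcc.trans (uIcc_subset_Icc hs ht))
  have hgvi : ∀ s ∈ Icc a b, ∀ t ∈ Icc a b,
      IntervalIntegrable (fun r => g r * v r) volume s t := fun s hs t ht =>
    (hvi s hs t ht).continuousOn_mul (hg.mono (uIcc_subset_Icc hs ht))
  have hsum : ∑ k ∈ Finset.range n, ∫ s in (t k)..(t (k + 1)), g s * v s =
      ∫ s in a..b, g s * v s := by
    rw [intervalIntegral.sum_integral_adjacent_intervals, ht0, htn]
    intro k hk
    exact hgvi _ (hmem k hk.le) _ (hmem (k + 1) hk)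
  have hsumA : ∑ k ∈ Finset.range n, ∫ s in (t k)..(t (k + 1)), |v s| = A := by
    rw [intervalIntegral.sum_integral_adjacent_intervals, ht0, htn]
    intro k hk
    exact (hvi _ (hmem k hk.le) _ (hmem (k + 1) hk)).abs
  rw [← hsum, ← Finset.sum_sub_distrib]
  -- On each cell the error is $\int (g(\xi_k)-g)\,v$, and $g$ oscillates by less than
  -- $\varepsilon/(A+1)$ there.
  have hterm : ∀ k ∈ Finset.range n,
      |g (ξ k) * (X (t (k + 1)) - X (t k)) - ∫ s in (t k)..(t (k + 1)), g s * v s| ≤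
        ε / (A + 1) * ∫ s in (t k)..(t (k + 1)), |v s| := by
    intro k hk
    rw [Finset.mem_range] at hk
    have hk1 := hmem k hk.le
    have hk2 := hmem (k + 1) hk
    obtain ⟨hp1, hp2, hp3⟩ := hpart k hk
    have hξ : ξ k ∈ Icc a b := ⟨hk1.1.trans hp1, hp2.trans hk2.2⟩
    rw [hX _ hk1 _ hk2, ← intervalIntegral.integral_const_mul,
      ← intervalIntegral.integral_sub ((hvi _ hk1 _ hk2).const_mul _) (hgvi _ hk1 _ hk2),
      ← intervalIntegral.integral_const_mul, ← Real.norm_eq_abs]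
    refine intervalIntegral.norm_integral_le_of_norm_le (hmono k hk) ?_
      ((hvi _ hk1 _ hk2).abs.const_mul _)
    filter_upwards with s hs
    have hs' : s ∈ Icc a b := ⟨hk1.1.trans hs.1.le, hs.2.trans hk2.2⟩
    rw [← sub_mul, norm_mul, Real.norm_eq_abs (v s)]
    refine mul_le_mul_of_nonneg_right ?_ (abs_nonneg _)
    have := hu (ξ k) hξ s hs' (by
      rw [Real.dist_eq, abs_lt]
      constructor <;> linarith [hs.1, hs.2])
    rw [dist_eq_norm] at this
    exact this.le
  refine ((Finset.abs_sum_le_sum_abs _ _).trans (Finset.sum_le_sum hterm)).trans_lt ?_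
  rw [← Finset.mul_sum, hsumA, div_mul_eq_mul_div, div_lt_iff₀ (by positivity)]
  nlinarith

end Stieltjes

/-! ### The algebra of signature functionals. -/

section Signature

/-- The density `(1, u)` of the time-extended integrated control. -/
noncomputable def timeExtendedDensity {m : ℕ} (u : ℝ → EuclideanSpace ℝ (Fin m))
    (j : Fin (m + 1)) (s : ℝ) : ℝ :=
  (Fin.cons 1 (u s).ofLp : Fin (m + 1) → ℝ) j

variable {m : ℕ} {T : ℝ} {u : ℝ → EuclideanSpace ℝ (Fin m)}

theorem integrableOn_coord (hu : IntegrableOn u (Icc 0 T)) (i : Fin m) :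
    IntegrableOn (fun s => u s i) (Icc 0 T) :=
  (EuclideanSpace.proj i : EuclideanSpace ℝ (Fin m) →L[ℝ] ℝ).integrable_comp hu

theorem integrableOn_timeExtendedDensity (hu : IntegrableOn u (Icc 0 T)) (j : Fin (m + 1)) :
    IntegrableOn (timeExtendedDensity u j) (Icc 0 T) := by
  refine Fin.cases ?_ (fun i => ?_) j
  · exact (integrableOn_const (by simp) : IntegrableOn (fun _ : ℝ => (1 : ℝ)) (Icc 0 T))
  · exact integrableOn_coord hu i

theorem timeExtended_sub (hT : 0 ≤ T) (hu : IntegrableOn u (Icc 0 T)) (j : Fin (m + 1))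
    {s t : ℝ} (hs : s ∈ Icc 0 T) (ht : t ∈ Icc 0 T) :
    timeExtended u t j - timeExtended u s j = ∫ r in s..t, timeExtendedDensity u j r := by
  have h0 : (0 : ℝ) ∈ Icc 0 T := ⟨le_rfl, hT⟩
  refine Fin.cases ?_ (fun i => ?_) j
  · simp [timeExtended, timeExtendedDensity]
  · have key : ∀ t ∈ Icc 0 T, (∫ r in (0 : ℝ)..t, u r) i = ∫ r in (0 : ℝ)..t, u r i := by
      intro t ht
      exact ((EuclideanSpace.proj i : EuclideanSpace ℝ (Fin m) →L[ℝ] ℝ).intervalIntegral_comp_comm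
        (intervalIntegrable_of_integrableOn_Icc hu h0 ht)).symm
    simp only [timeExtended, timeExtendedDensity, Fin.cons_succ]
    rw [key t ht, key s hs, intervalIntegral.integral_interval_sub_left
      (intervalIntegrable_of_integrableOn_Icc (integrableOn_coord hu i) h0 ht)
      (intervalIntegrable_of_integrableOn_Icc (integrableOn_coord hu i) h0 hs)]

/-- Continuity at level `k` gives the Lebesgue formula at level `k + 1`, which in turn gives
continuity there. Taking `hc` as a hypothesis lets that induction run. -/
theorem iteratedIntegral_timeExtended_succ_of_continuousOn (hT : 0 ≤ T)
    (hu : IntegrableOn u (Icc 0 T)) {k : ℕ} (w : Fin (k + 1) → Fin (m + 1))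
    (hc : ContinuousOn (iteratedIntegral (timeExtended u) 0 k (Fin.init w)) (Icc 0 T))
    {t : ℝ} (ht : t ∈ Icc 0 T) :
    iteratedIntegral (timeExtended u) 0 (k + 1) w t =
      ∫ s in (0 : ℝ)..t, iteratedIntegral (timeExtended u) 0 k (Fin.init w) s *
        timeExtendedDensity u (w (Fin.last k)) s := by
  have hsub : Icc 0 t ⊆ Icc 0 T := Icc_subset_Icc_right ht.2
  exact (hasStieltjesIntegral_of_primitive ht.1 (hc.mono hsub)
    ((integrableOn_timeExtendedDensity hu (w (Fin.last k))).mono_set hsub)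
    (fun r hr s hs => timeExtended_sub hT hu _ (hsub hr) (hsub hs))).stieltjesIntegral_eq

theorem continuousOn_iteratedIntegral_timeExtended (hT : 0 ≤ T) (hu : IntegrableOn u (Icc 0 T))
    (k : ℕ) (w : Fin k → Fin (m + 1)) :
    ContinuousOn (iteratedIntegral (timeExtended u) 0 k w) (Icc 0 T) := by
  induction k with
  | zero => exact continuousOn_const
  | succ k ih =>
    have hi : IntegrableOn (fun s => iteratedIntegral (timeExtended u) 0 k (Fin.init w) s *
        timeExtendedDensity u (w (Fin.last k)) s) (Icc 0 T) :=
      (integrableOn_timeExtendedDensity hu _).continuousOn_mul (ih _) isCompact_Icc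
    exact (continuousOn_primitive_Icc hT hi).congr fun t ht =>
      iteratedIntegral_timeExtended_succ_of_continuousOn hT hu w (ih _) ht

theorem iteratedIntegral_timeExtended_succ (hT : 0 ≤ T) (hu : IntegrableOn u (Icc 0 T))
    {k : ℕ} (w : Fin (k + 1) → Fin (m + 1)) {t : ℝ} (ht : t ∈ Icc 0 T) :
    iteratedIntegral (timeExtended u) 0 (k + 1) w t =
      ∫ s in (0 : ℝ)..t, iteratedIntegral (timeExtended u) 0 k (Fin.init w) s *
        timeExtendedDensity u (w (Fin.last k)) s :=
  iteratedIntegral_timeExtended_succ_of_continuousOn hT hu w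
    (continuousOn_iteratedIntegral_timeExtended hT hu k _) ht

/-- `F` is, on `[0,T]`, a linear functional of the signatures of the time-extended integrated
controls `U i`, with weights independent of time and of the control. -/
def IsSignatureFunctional {ι : Type*} (T : ℝ) (U : ι → ℝ → EuclideanSpace ℝ (Fin m))
    (F : ι → ℝ → ℝ) : Prop :=
  ∃ l : Weights (m + 1), ∀ i, ∀ t ∈ Icc 0 T,
    F i t = pairing l (signature (timeExtended (U i)) 0 t)

variable {ι : Type*} {U : ι → ℝ → EuclideanSpace ℝ (Fin m)} {F G : ι → ℝ → ℝ}

theorem pairing_add {n : ℕ} (l l' : Weights n) (S : (k : ℕ) → (Fin k → Fin n) → ℝ) :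
    pairing (l + l') S = pairing l S + pairing l' S :=
  Finsupp.sum_add_index' (fun _ => zero_mul _) (fun _ _ _ => add_mul _ _ _)

theorem pairing_smul {n : ℕ} (c : ℝ) (l : Weights n) (S : (k : ℕ) → (Fin k → Fin n) → ℝ) :
    pairing (c • l) S = c * pairing l S := by
  unfold pairing
  rw [Finsupp.sum_smul_index (fun _ => zero_mul _), Finsupp.mul_sum]
  simp only [mul_assoc]

theorem IsSignatureFunctional.congr (hF : IsSignatureFunctional T U F)
    (h : ∀ i, ∀ t ∈ Icc 0 T, G i t = F i t) : IsSignatureFunctional T U G := by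
  obtain ⟨l, hl⟩ := hF
  exact ⟨l, fun i t ht => (h i t ht).trans (hl i t ht)⟩

theorem IsSignatureFunctional.add (hF : IsSignatureFunctional T U F)
    (hG : IsSignatureFunctional T U G) : IsSignatureFunctional T U (fun i t => F i t + G i t) := by
  obtain ⟨l, hl⟩ := hF
  obtain ⟨l', hl'⟩ := hG
  exact ⟨l + l', fun i t ht => by simp only [hl i t ht, hl' i t ht, pairing_add]⟩

theorem IsSignatureFunctional.const_mul (c : ℝ) (hF : IsSignatureFunctional T U F) :
    IsSignatureFunctional T U (fun i t => c * F i t) := by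
  obtain ⟨l, hl⟩ := hF
  exact ⟨c • l, fun i t ht => by simp only [hl i t ht, pairing_smul]⟩

theorem isSignatureFunctional_iteratedIntegral (k : ℕ) (w : Fin k → Fin (m + 1)) :
    IsSignatureFunctional T U (fun i t => iteratedIntegral (timeExtended (U i)) 0 k w t) :=
  ⟨Finsupp.single ⟨k, w⟩ 1, fun i t _ => by
    simp [pairing, signature]⟩

theorem isSignatureFunctional_const (c : ℝ) :
    IsSignatureFunctional T U (fun _ _ => c) :=
  ((isSignatureFunctional_iteratedIntegral 0 Fin.elim0).const_mul c).congr fun i t _ => by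
    simp [iteratedIntegral]

theorem isSignatureFunctional_sum {α : Type*} (s : Finset α) {F : α → ι → ℝ → ℝ}
    (hF : ∀ a ∈ s, IsSignatureFunctional T U (F a)) :
    IsSignatureFunctional T U (fun i t => ∑ a ∈ s, F a i t) := by
  classical
  induction s using Finset.induction_on with
  | empty => simpa using isSignatureFunctional_const 0
  | insert a s ha ih =>
    refine ((hF a (Finset.mem_insert_self _ _)).add
      (ih fun b hb => hF b (Finset.mem_insert_of_mem hb))).congr fun i t _ => ?_
    rw [Finset.sum_insert ha]

/-- Signature functionals are stable under integration against a component of the path. -/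
theorem IsSignatureFunctional.integral_mul (hT : 0 ≤ T) (hU : ∀ i, IntegrableOn (U i) (Icc 0 T))
    (hF : IsSignatureFunctional T U F) (j : Fin (m + 1)) :
    IsSignatureFunctional T U
      (fun i t => ∫ s in (0 : ℝ)..t, F i s * timeExtendedDensity (U i) j s) := by
  obtain ⟨l, hl⟩ := hF
  have h0 : (0 : ℝ) ∈ Icc 0 T := ⟨le_rfl, hT⟩
  refine (isSignatureFunctional_sum l.support (F := fun w i t => l w *
    iteratedIntegral (timeExtended (U i)) 0 (w.1 + 1) (Fin.snoc w.2 j) t) fun w _ =>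
      (isSignatureFunctional_iteratedIntegral _ _).const_mul _).congr fun i t ht => ?_
  have hsub := uIcc_subset_Icc h0 ht
  have hd := intervalIntegrable_of_integrableOn_Icc
    (integrableOn_timeExtendedDensity (hU i) j) h0 ht
  have : ∫ s in (0 : ℝ)..t, F i s * timeExtendedDensity (U i) j s =
      ∫ s in (0 : ℝ)..t, ∑ w ∈ l.support,
        l w * (iteratedIntegral (timeExtended (U i)) 0 w.1 w.2 s *
          timeExtendedDensity (U i) j s) := by
    refine intervalIntegral.integral_congr fun s hs => ?_
    rw [hl i s (hsub hs)]
    simp only [pairing, Finsupp.sum, signature, Finset.sum_mul, mul_assoc]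
  rw [this, intervalIntegral.integral_finsetSum]
  · refine Finset.sum_congr rfl fun w _ => ?_
    rw [intervalIntegral.integral_const_mul, iteratedIntegral_timeExtended_succ hT (hU i) _ ht]
    simp only [Fin.init_snoc, Fin.snoc_last]
  · intro w _
    exact (hd.continuousOn_mul
      ((continuousOn_iteratedIntegral_timeExtended hT (hU i) _ _).mono hsub)).const_mul _

/-- The shuffle property: products of iterated integrals are signature functionals. -/
theorem isSignatureFunctional_iteratedIntegral_mul (hT : 0 ≤ T)
    (hU : ∀ i, IntegrableOn (U i) (Icc 0 T)) (N : ℕ) :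
    ∀ (k k' : ℕ), k + k' = N → ∀ (w : Fin k → Fin (m + 1)) (w' : Fin k' → Fin (m + 1)),
    IsSignatureFunctional T U (fun i t => iteratedIntegral (timeExtended (U i)) 0 k w t *
      iteratedIntegral (timeExtended (U i)) 0 k' w' t) := by
  have h0 : (0 : ℝ) ∈ Icc 0 T := ⟨le_rfl, hT⟩
  induction N using Nat.strong_induction_on with
  | _ N ih =>
    intro k k' hN w w'
    rcases k with _ | k
    · exact (isSignatureFunctional_iteratedIntegral k' w').congr fun i t _ => by
        simp [iteratedIntegral]
    rcases k' with _ | k'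
    · exact (isSignatureFunctional_iteratedIntegral (k + 1) w).congr fun i t _ => by
        simp [iteratedIntegral]
    -- Differentiating the product removes the last letter of one factor or the other. Either way
    -- the total length drops by one, and the removed letter is restored by integration.
    have h1 := (ih (k + (k' + 1)) (by omega) k (k' + 1) rfl (Fin.init w) w').integral_mul hT hU
      (w (Fin.last k))
    have h2 := (ih (k + 1 + k') (by omega) (k + 1) k' rfl w (Fin.init w')).integral_mul hT hU
      (w' (Fin.last k'))
    refine (h1.add h2).congr fun i t ht => ?_
    have hsub := uIcc_subset_Icc h0 ht
    have hc : ∀ k (w : Fin k → Fin (m + 1)),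
        ContinuousOn (iteratedIntegral (timeExtended (U i)) 0 k w) (uIcc 0 t) := fun k w =>
      (continuousOn_iteratedIntegral_timeExtended hT (hU i) k w).mono hsub
    have hd : ∀ j, IntervalIntegrable (timeExtendedDensity (U i) j) volume 0 t := fun j =>
      intervalIntegrable_of_integrableOn_Icc (integrableOn_timeExtendedDensity (hU i) j) h0 ht
    have hp := primitive_mul_primitive 0 0
      ((hd (w (Fin.last k))).continuousOn_mul (hc k (Fin.init w)))
      ((hd (w' (Fin.last k'))).continuousOn_mul (hc k' (Fin.init w')))
    simp only [zero_add, mul_zero] at hp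
    rw [iteratedIntegral_timeExtended_succ hT (hU i) w ht,
      iteratedIntegral_timeExtended_succ hT (hU i) w' ht, hp,
      ← intervalIntegral.integral_add]
    · refine intervalIntegral.integral_congr fun s hs => ?_
      rw [← iteratedIntegral_timeExtended_succ hT (hU i) w (hsub hs),
        ← iteratedIntegral_timeExtended_succ hT (hU i) w' (hsub hs)]
      ring
    · exact (hd _).continuousOn_mul ((hc _ _).mul (hc _ _))
    · exact (hd _).continuousOn_mul ((hc _ _).mul (hc _ _))

theorem IsSignatureFunctional.mul (hT : 0 ≤ T) (hU : ∀ i, IntegrableOn (U i) (Icc 0 T))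
    (hF : IsSignatureFunctional T U F) (hG : IsSignatureFunctional T U G) :
    IsSignatureFunctional T U (fun i t => F i t * G i t) := by
  obtain ⟨l, hl⟩ := hF
  obtain ⟨l', hl'⟩ := hG
  refine (isSignatureFunctional_sum l.support (F := fun w i t => ∑ w' ∈ l'.support,
    l w * l' w' * (iteratedIntegral (timeExtended (U i)) 0 w.1 w.2 t *
      iteratedIntegral (timeExtended (U i)) 0 w'.1 w'.2 t)) fun w _ =>
    isSignatureFunctional_sum _ fun w' _ =>
      (isSignatureFunctional_iteratedIntegral_mul hT hU _ _ _ rfl _ _).const_mul _).congr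
    fun i t ht => ?_
  rw [hl i t ht, hl' i t ht]
  simp only [pairing, Finsupp.sum, signature, Finset.sum_mul_sum]
  refine Finset.sum_congr rfl fun w _ => Finset.sum_congr rfl fun w' _ => ?_
  ring

theorem isSignatureFunctional_time (hT : 0 ≤ T) (hU : ∀ i, IntegrableOn (U i) (Icc 0 T)) :
    IsSignatureFunctional T U (fun _ t => t) :=
  ((isSignatureFunctional_const 1).integral_mul hT hU 0).congr fun i t _ => by
    simp [timeExtendedDensity]

theorem isSignatureFunctional_time_pow (hT : 0 ≤ T) (hU : ∀ i, IntegrableOn (U i) (Icc 0 T))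
    (n : ℕ) : IsSignatureFunctional T U (fun _ t => t ^ n) := by
  induction n with
  | zero => simpa using isSignatureFunctional_const 1
  | succ n ih =>
    simpa only [pow_succ] using ih.mul hT hU (isSignatureFunctional_time hT hU)

theorem isSignatureFunctional_moment (hT : 0 ≤ T) (hU : ∀ i, IntegrableOn (U i) (Icc 0 T))
    (n : ℕ) (j : Fin m) :
    IsSignatureFunctional T U (fun i t => ∫ s in (0 : ℝ)..t, s ^ n * U i s j) :=
  ((isSignatureFunctional_time_pow hT hU n).integral_mul hT hU j.succ).congr fun i t _ => by
    simp [timeExtendedDensity]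

end Signature

/-! ### Stone–Weierstrass on fibres, and determination by moments. -/

/-- The Stone–Weierstrass theorem for subalgebras that need not separate points: a continuous
function which is constant on the fibres of the subalgebra is approximated by its elements. -/
theorem exists_mem_subalgebra_norm_sub_lt {X : Type*} [TopologicalSpace X] [CompactSpace X]
    (A : Subalgebra ℝ C(X, ℝ)) (y : C(X, ℝ))
    (hy : ∀ a b, (∀ g ∈ A, g a = g b) → y a = y b) {ε : ℝ} (hε : 0 < ε) :
    ∃ g ∈ A, ∀ x, |g x - y x| < ε := by
  -- Evaluation at all elements of `A` identifies exactly the points that `A` does not separate.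
  let Φ : X → (A → ℝ) := fun x g => (g : C(X, ℝ)) x
  have hΦ : Continuous Φ := continuous_pi fun g => (g : C(X, ℝ)).continuous
  let π : C(X, range Φ) := ⟨rangeFactorization Φ, hΦ.subtype_mk _⟩
  have hsurj : Function.Surjective π := rangeFactorization_surjective
  have hcomp : CompactSpace (range Φ) := isCompact_iff_compactSpace.1 (isCompact_range hΦ)
  -- A continuous surjection from a compact space to a Hausdorff one is a quotient map, so `y`
  -- descends to a continuous function on the image.
  have hq : Topology.IsQuotientMap π :=
    Topology.IsQuotientMap.of_surjective_continuous hsurj π.continuous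
  choose σ hσ using hsurj
  have hfib : ∀ x, y (σ (π x)) = y x := fun x => hy _ _ fun g hg =>
    congrFun (congrArg Subtype.val (hσ (π x))) ⟨g, hg⟩
  have hgc : Continuous fun z => y (σ z) := by
    rw [hq.continuous_iff]
    exact y.continuous.congr fun x => (hfib x).symm
  -- The functions on the image whose pullback lies in `A`. They include the coordinates, which
  -- separate points.
  let B : Subalgebra ℝ C(range Φ, ℝ) := A.comap (ContinuousMap.compRightAlgHom ℝ ℝ π)
  have hsep : B.SeparatesPoints := by
    intro a b hab
    obtain ⟨g, hg⟩ := Function.ne_iff.1 (fun h => hab (Subtype.ext h))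
    refine ⟨_, ⟨⟨fun z => z.1 g, (continuous_apply g).comp continuous_subtype_val⟩, ?_, rfl⟩, hg⟩
    exact g.2
  obtain ⟨g, hg⟩ := ContinuousMap.exists_mem_subalgebra_near_continuous_of_separatesPoints B hsep
    _ hgc ε hε
  refine ⟨ContinuousMap.compRightAlgHom ℝ ℝ π g, g.2, fun x => ?_⟩
  have := hg (π x)
  rw [hfib x] at this
  exact this

/-- An integrable function on a bounded interval all of whose moments vanish is zero almost
everywhere. -/
theorem ae_eq_zero_of_moments_eq_zero {h : ℝ → ℝ} {t : ℝ} (ht : 0 ≤ t)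
    (hh : IntegrableOn h (Icc 0 t)) (hm : ∀ n : ℕ, ∫ s in (0 : ℝ)..t, s ^ n * h s = 0) :
    ∀ᵐ s, s ∈ Ioo 0 t → h s = 0 := by
  have h0 : (0 : ℝ) ∈ Icc 0 t := ⟨le_rfl, ht⟩
  have htt : t ∈ Icc 0 t := ⟨ht, le_rfl⟩
  have hi : IntervalIntegrable h volume 0 t := intervalIntegrable_of_integrableOn_Icc hh h0 htt
  have hmul : ∀ g : ℝ → ℝ, Continuous g → IntervalIntegrable (fun s => g s * h s) volume 0 t :=
    fun g hg => hi.continuousOn_mul hg.continuousOn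
  have hpoly : ∀ p : Polynomial ℝ, ∫ s in (0 : ℝ)..t, p.eval s * h s = 0 := by
    intro p
    simp only [Polynomial.eval_eq_sum_range, Finset.sum_mul, mul_assoc]
    rw [intervalIntegral.integral_finsetSum]
    · refine Finset.sum_eq_zero fun n _ => ?_
      rw [intervalIntegral.integral_const_mul, hm, mul_zero]
    · intro n _
      exact (hmul _ (continuous_pow n)).const_mul _
  have hcont : ∀ g : ℝ → ℝ, Continuous g → ∫ s in (0 : ℝ)..t, g s * h s = 0 := by
    intro g hg
    set A := ∫ s in (0 : ℝ)..t, |h s| with hA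
    have hA0 : 0 ≤ A := intervalIntegral.integral_nonneg ht fun s _ => abs_nonneg _
    refine abs_eq_zero.1 (le_antisymm (le_of_forall_pos_le_add fun ε hε => ?_) (abs_nonneg _))
    obtain ⟨p, hp⟩ := exists_polynomial_near_of_continuousOn 0 t g hg.continuousOn
      (ε / (A + 1)) (by positivity)
    have heq : ∫ s in (0 : ℝ)..t, g s * h s = ∫ s in (0 : ℝ)..t, (g s - p.eval s) * h s := by
      simp only [sub_mul]
      rw [intervalIntegral.integral_sub (hmul g hg) (hmul _ p.continuous), hpoly, sub_zero]
    rw [heq, zero_add, ← Real.norm_eq_abs]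
    refine (intervalIntegral.norm_integral_le_of_norm_le ht (g := fun s => ε / (A + 1) * |h s|) ?_
      (hi.abs.const_mul _)).trans ?_
    · filter_upwards with s hs
      rw [norm_mul, Real.norm_eq_abs, Real.norm_eq_abs, abs_sub_comm]
      exact mul_le_mul_of_nonneg_right (hp s ⟨hs.1.le, hs.2⟩).le (abs_nonneg _)
    · rw [intervalIntegral.integral_const_mul, div_mul_eq_mul_div, div_le_iff₀ (by positivity)]
      nlinarith
  refine isOpen_Ioo.ae_eq_zero_of_integral_contDiff_smul_eq_zero
    ((hh.mono_set Ioo_subset_Icc_self).locallyIntegrableOn) fun g hg _ hsupp => ?_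
  rw [← setIntegral_eq_integral_of_forall_compl_eq_zero (s := Ioo 0 t)]
  · have := hcont g hg.continuous
    rwa [intervalIntegral.integral_of_le ht, integral_Ioc_eq_integral_Ioo] at this
  · intro s hs
    rw [image_eq_zero_of_notMem_tsupport fun hs' => hs (hsupp hs'), zero_smul]

theorem ae_eq_of_moments_eq {m : ℕ} {u v : ℝ → EuclideanSpace ℝ (Fin m)} {t : ℝ} (ht : 0 ≤ t)
    (hu : IntegrableOn u (Icc 0 t)) (hv : IntegrableOn v (Icc 0 t))
    (h : ∀ (n : ℕ) (j : Fin m),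
      ∫ s in (0 : ℝ)..t, s ^ n * u s j = ∫ s in (0 : ℝ)..t, s ^ n * v s j) :
    ∀ᵐ s, s ∈ Ioo 0 t → u s = v s := by
  have key : ∀ j, ∀ᵐ s, s ∈ Ioo 0 t → u s j - v s j = 0 := by
    intro j
    refine ae_eq_zero_of_moments_eq_zero ht
      ((integrableOn_coord hu j).sub (integrableOn_coord hv j)) fun n => ?_
    simp only [mul_sub]
    have hi : ∀ {w : ℝ → EuclideanSpace ℝ (Fin m)}, IntegrableOn w (Icc 0 t) →
        IntervalIntegrable (fun s => s ^ n * w s j) volume 0 t := fun hw =>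
      (intervalIntegrable_of_integrableOn_Icc (integrableOn_coord hw j) ⟨le_rfl, ht⟩
        ⟨ht, le_rfl⟩).continuousOn_mul (continuous_pow n).continuousOn
    rw [intervalIntegral.integral_sub (hi hu) (hi hv), h, sub_self]
  filter_upwards [ae_all_iff.2 key] with s hs hsm
  ext j
  exact sub_eq_zero.1 (hs j hsm)

/-! ### Joint continuity in time and control. -/

section Controls

variable {m : ℕ} {T : ℝ}

theorem Control.integrableOn (u : Control m T) :
    IntegrableOn (u : ℝ → EuclideanSpace ℝ (Fin m)) (Icc 0 T) :=
  (Lp.memLp u).integrable one_le_two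

theorem Control.integrableOn_norm_sq (u : Control m T) :
    IntegrableOn (fun s => ‖(u : ℝ → EuclideanSpace ℝ (Fin m)) s‖ ^ 2) (Icc 0 T) :=
  (Lp.memLp u).integrable_norm_pow two_ne_zero

theorem Control.integral_norm_sq (hT : 0 ≤ T) (u : Control m T) :
    ∫ s in (0 : ℝ)..T, ‖(u : ℝ → EuclideanSpace ℝ (Fin m)) s‖ ^ 2 = ‖u‖ ^ 2 := by
  rw [intervalIntegral.integral_of_le hT, ← integral_Icc_eq_integral_Ioc,
    ← real_inner_self_eq_norm_sq u, L2.inner_def]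
  simp

/-- Integrate $a\le\eta+\eta^{-1}a^2$ over $[0,T]$, a substitute for Cauchy–Schwarz. -/
theorem Control.integral_norm_sub_le (hT : 0 ≤ T) (u v : Control m T) {η : ℝ}
    (h : ‖u - v‖ < η) :
    ∫ s in (0 : ℝ)..T, ‖(u : ℝ → EuclideanSpace ℝ (Fin m)) s -
      (v : ℝ → EuclideanSpace ℝ (Fin m)) s‖ ≤ η * (T + 1) := by
  have hη : 0 < η := (norm_nonneg _).trans_lt h
  have h0 : (0 : ℝ) ∈ Icc 0 T := ⟨le_rfl, hT⟩
  have hTT : T ∈ Icc 0 T := ⟨hT, le_rfl⟩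
  have hae : ∫ s in (0 : ℝ)..T, ‖(u : ℝ → EuclideanSpace ℝ (Fin m)) s -
      (v : ℝ → EuclideanSpace ℝ (Fin m)) s‖ =
      ∫ s in (0 : ℝ)..T, ‖((u - v : Control m T) : ℝ → EuclideanSpace ℝ (Fin m)) s‖ := by
    rw [intervalIntegral.integral_of_le hT, intervalIntegral.integral_of_le hT,
      ← integral_Icc_eq_integral_Ioc, ← integral_Icc_eq_integral_Ioc]
    refine integral_congr_ae ?_
    filter_upwards [Lp.coeFn_sub u v] with s hs
    rw [hs, Pi.sub_apply]
  rw [hae]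
  have hsq := intervalIntegrable_of_integrableOn_Icc (u - v).integrableOn_norm_sq h0 hTT
  have hle : ∫ s in (0 : ℝ)..T, ‖((u - v : Control m T) : ℝ → EuclideanSpace ℝ (Fin m)) s‖ ≤
      ∫ s in (0 : ℝ)..T,
        (η + η⁻¹ * ‖((u - v : Control m T) : ℝ → EuclideanSpace ℝ (Fin m)) s‖ ^ 2) := by
    refine intervalIntegral.integral_mono_on hT
      (intervalIntegrable_of_integrableOn_Icc (u - v).integrableOn.norm h0 hTT)
      (intervalIntegrable_const.add (hsq.const_mul _)) fun s _ => ?_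
    set a := ‖((u - v : Control m T) : ℝ → EuclideanSpace ℝ (Fin m)) s‖
    have : η * a ≤ η * (η + η⁻¹ * a ^ 2) := by
      rw [mul_add, mul_inv_cancel_left₀ hη.ne']
      nlinarith [sq_nonneg (η - a), sq_nonneg (η + a)]
    exact le_of_mul_le_mul_left this hη
  refine hle.trans ?_
  rw [intervalIntegral.integral_add intervalIntegrable_const (hsq.const_mul _),
    intervalIntegral.integral_const_mul, Control.integral_norm_sq hT]
  simp only [intervalIntegral.integral_const, sub_zero, smul_eq_mul]
  have h1 : ‖u - v‖ ^ 2 ≤ η ^ 2 := by gcongr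
  have h2 : η⁻¹ * ‖u - v‖ ^ 2 ≤ η⁻¹ * η ^ 2 := by gcongr
  have h3 : η⁻¹ * η ^ 2 = η := by field_simp
  linarith

/-- A function of two variables that is continuous in the first one and equicontinuous in the
second one is jointly continuous. -/
theorem continuous_prod_of_equicontinuous {X Y Z : Type*} [TopologicalSpace X]
    [PseudoMetricSpace Y] [PseudoMetricSpace Z] {H : X × Y → Z}
    (h₁ : ∀ y, Continuous fun x => H (x, y))
    (h₂ : ∀ y, ∀ ε > 0, ∃ δ > 0, ∀ y', dist y' y < δ → ∀ x, dist (H (x, y')) (H (x, y)) < ε) :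
    Continuous H := by
  rw [continuous_iff_continuousAt]
  rintro ⟨x, y⟩
  rw [ContinuousAt, Metric.tendsto_nhds]
  intro ε hε
  obtain ⟨δ, hδ, h⟩ := h₂ y (ε / 2) (half_pos hε)
  have hx := Metric.tendsto_nhds.1 ((h₁ y).tendsto x) (ε / 2) (half_pos hε)
  rw [nhds_prod_eq]
  filter_upwards [hx.prod_mk (Metric.ball_mem_nhds y hδ)] with p hp
  have h3 := h p.2 hp.2 p.1
  have h4 := hp.1
  exact (dist_triangle _ (H (p.1, y)) _).trans_lt (by linarith)

theorem continuous_moment (hT : 0 ≤ T) (K : Set (Control m T)) (n : ℕ) (j : Fin m) :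
    Continuous fun q : Icc (0 : ℝ) T × K => ∫ s in (0 : ℝ)..q.1,
      s ^ n * ((q.2 : Control m T) : ℝ → EuclideanSpace ℝ (Fin m)) s j := by
  have h0 : (0 : ℝ) ∈ Icc 0 T := ⟨le_rfl, hT⟩
  have hTT : T ∈ Icc 0 T := ⟨hT, le_rfl⟩
  have hi : ∀ u : Control m T, IntegrableOn
      (fun s => s ^ n * (u : ℝ → EuclideanSpace ℝ (Fin m)) s j) (Icc 0 T) := fun u =>
    (integrableOn_coord u.integrableOn j).continuousOn_mul (continuous_pow n).continuousOn
      isCompact_Icc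
  refine continuous_prod_of_equicontinuous (fun u => ?_) fun u ε hε => ?_
  · exact continuousOn_iff_continuous_domRestrict.1 (continuousOn_primitive_Icc hT (hi u))
  have hpos : 0 < T ^ n * (T + 1) + 1 := by positivity
  refine ⟨ε / (T ^ n * (T + 1) + 1), by positivity, fun v hv t => ?_⟩
  rw [Subtype.dist_eq, dist_eq_norm] at hv
  have hle := Control.integral_norm_sub_le hT _ _ hv
  have hdI : IntegrableOn (fun s => T ^ n * ‖((v : Control m T) : ℝ → EuclideanSpace ℝ (Fin m)) s -
      ((u : Control m T) : ℝ → EuclideanSpace ℝ (Fin m)) s‖) (Icc 0 T) :=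
    ((v : Control m T).integrableOn.sub (u : Control m T).integrableOn).norm.const_mul _
  rw [dist_eq_norm, ← intervalIntegral.integral_sub
    (intervalIntegrable_of_integrableOn_Icc (hi v) h0 t.2)
    (intervalIntegrable_of_integrableOn_Icc (hi u) h0 t.2)]
  refine (intervalIntegral.norm_integral_le_of_norm_le t.2.1 ?_
    (intervalIntegrable_of_integrableOn_Icc hdI h0 t.2)).trans_lt ?_
  · filter_upwards with s hs
    rw [← mul_sub, norm_mul, norm_pow, Real.norm_eq_abs s, abs_of_nonneg hs.1.le]
    refine mul_le_mul (pow_le_pow_left₀ hs.1.le (hs.2.trans t.2.2) n) ?_ (norm_nonneg _)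
      (by positivity)
    exact PiLp.norm_apply_le (((v : Control m T) : ℝ → EuclideanSpace ℝ (Fin m)) s -
      ((u : Control m T) : ℝ → EuclideanSpace ℝ (Fin m)) s) j
  · have hmono : ∫ s in (0 : ℝ)..t, T ^ n *
        ‖((v : Control m T) : ℝ → EuclideanSpace ℝ (Fin m)) s -
          ((u : Control m T) : ℝ → EuclideanSpace ℝ (Fin m)) s‖ ≤
        ∫ s in (0 : ℝ)..T, T ^ n *
        ‖((v : Control m T) : ℝ → EuclideanSpace ℝ (Fin m)) s -
          ((u : Control m T) : ℝ → EuclideanSpace ℝ (Fin m)) s‖ :=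
      intervalIntegral.integral_mono_interval le_rfl t.2.1 t.2.2
        (Filter.Eventually.of_forall fun s => by positivity)
        (intervalIntegrable_of_integrableOn_Icc hdI h0 hTT)
    refine hmono.trans_lt ?_
    rw [intervalIntegral.integral_const_mul]
    refine (mul_le_mul_of_nonneg_left hle (by positivity)).trans_lt ?_
    have : T ^ n * (ε / (T ^ n * (T + 1) + 1) * (T + 1)) =
        ε * (T ^ n * (T + 1)) / (T ^ n * (T + 1) + 1) := by ring
    rw [this, div_lt_iff₀ hpos]
    nlinarith

variable {d : ℕ}
  {f₀ : EuclideanSpace ℝ (Fin d) → EuclideanSpace ℝ (Fin d)}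
  {f : EuclideanSpace ℝ (Fin d) → Matrix (Fin d) (Fin m) ℝ}
  {x₀ : EuclideanSpace ℝ (Fin d)}

/-- Solutions are jointly continuous in time and in the control, on bounded sets of controls. -/
theorem continuous_solution {C : ℝ} (hT : 0 ≤ T) (hC0 : 0 ≤ C)
    (hf₀ : IsLocallyLipschitz f₀) (hf : IsLocallyLipschitz f)
    (hC : ∀ x, 2 * inner ℝ x (f₀ x) + ‖f x‖ ^ 2 ≤ C * (1 + ‖x‖ ^ 2))
    {x : Control m T → ℝ → EuclideanSpace ℝ (Fin d)}
    (hx : ∀ u : Control m T, IsSolution T f₀ f x₀ u (x u))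
    {K : Set (Control m T)} (hK : Bornology.IsBounded K) :
    Continuous fun q : Icc (0 : ℝ) T × K => x q.2 q.1 := by
  obtain ⟨M, hM⟩ := hK.exists_norm_le
  set Q := (1 + ‖x₀‖ ^ 2) * Real.exp (T * C + M ^ 2) with hQ
  have hQ0 : 0 < Q := by positivity
  have hbd : ∀ u ∈ K, ∀ t ∈ Icc 0 T, ‖x u t‖ ≤ Q := by
    intro u hu t ht
    have h1 := (hx u).one_add_norm_sq_le hT hC0 hC u.integrableOn_norm_sq t ht
    rw [intervalIntegral.integral_add intervalIntegrable_const
      (intervalIntegrable_of_integrableOn_Icc u.integrableOn_norm_sq ⟨le_rfl, hT⟩ ⟨hT, le_rfl⟩),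
      Control.integral_norm_sq hT, intervalIntegral.integral_const, sub_zero, smul_eq_mul] at h1
    have h2 : (1 + ‖x₀‖ ^ 2) * Real.exp (T * C + ‖u‖ ^ 2) ≤ Q := by
      rw [hQ]
      gcongr
      exact hM u hu
    nlinarith [sq_nonneg (‖x u t‖ - 1)]
  obtain ⟨L, F, hL, hF, h₀, h₁, h₂⟩ := exists_lipschitz_bounds hf₀ hf hQ0
  refine continuous_prod_of_equicontinuous (fun u => ?_) fun u ε hε => ?_
  · exact continuousOn_iff_continuous_domRestrict.1 (hx u).continuousOn
  -- `E` depends on the base control `u` only, so the `δ` chosen from it serves all nearby `v`.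
  set E := Real.exp (∫ s in (0 : ℝ)..T,
    L * (1 + ‖((u : Control m T) : ℝ → EuclideanSpace ℝ (Fin m)) s‖)) with hE
  have hE0 : 0 < E := Real.exp_pos _
  have hpos : 0 < F * (T + 1) * E + 1 := by positivity
  refine ⟨ε / (F * (T + 1) * E + 1), by positivity, fun v hv t => ?_⟩
  rw [Subtype.dist_eq, dist_eq_norm, norm_sub_rev] at hv
  have hle := Control.integral_norm_sub_le hT _ _ hv
  rw [dist_eq_norm, norm_sub_rev]
  refine (IsSolution.norm_sub_le hT (hx u) (hx v) (u : Control m T).integrableOn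
    (v : Control m T).integrableOn (hbd u u.2) (hbd v v.2) hL h₀ h₁ hF h₂ t t.2).trans_lt ?_
  rw [← hE]
  have h3 : F * (∫ s in (0 : ℝ)..T, ‖((u : Control m T) : ℝ → EuclideanSpace ℝ (Fin m)) s -
      ((v : Control m T) : ℝ → EuclideanSpace ℝ (Fin m)) s‖) * E ≤
      F * (ε / (F * (T + 1) * E + 1) * (T + 1)) * E := by gcongr
  refine h3.trans_lt ?_
  have h4 : F * (ε / (F * (T + 1) * E + 1) * (T + 1)) * E =
      ε * (F * (T + 1) * E) / (F * (T + 1) * E + 1) := by ring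
  rw [h4, div_lt_iff₀ hpos]
  nlinarith

/-- The algebra of continuous functions on `[0,T] × K` given by linear functionals of the
signature. -/
noncomputable def signatureSubalgebra (hT : 0 ≤ T) (K : Set (Control m T)) :
    Subalgebra ℝ C(Icc (0 : ℝ) T × K, ℝ) where
  -- Continuity is part of `g`, so it has to be proved only for the elements that identify the
  -- fibres: time and the moments.
  carrier := {g | ∃ F, IsSignatureFunctional T
    (fun u : K => ((u : Control m T) : ℝ → EuclideanSpace ℝ (Fin m))) F ∧ ∀ q, g q = F q.2 q.1}
  mul_mem' := by
    rintro g h ⟨F, hF, hg⟩ ⟨G, hG, hh⟩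
    exact ⟨_, hF.mul hT (fun u => (u : Control m T).integrableOn) hG, fun q => by
      simp [hg, hh]⟩
  add_mem' := by
    rintro g h ⟨F, hF, hg⟩ ⟨G, hG, hh⟩
    exact ⟨_, hF.add hG, fun q => by simp [hg, hh]⟩
  algebraMap_mem' c := ⟨_, isSignatureFunctional_const c, fun q => rfl⟩

end Controls

end SigApprox

/-! ### The approximation theorem. -/

theorem corollary3p6 {d m p : ℕ} (T : ℝ) (hT : 0 < T)
    (f₀ : EuclideanSpace ℝ (Fin d) → EuclideanSpace ℝ (Fin d))
    (f : EuclideanSpace ℝ (Fin d) → Matrix (Fin d) (Fin m) ℝ)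
    (c : EuclideanSpace ℝ (Fin d) → EuclideanSpace ℝ (Fin p))
    (x₀ : EuclideanSpace ℝ (Fin d))
    (hf₀ : SigApprox.IsLocallyLipschitz f₀)
    (hf : SigApprox.IsLocallyLipschitz f)
    (hc : SigApprox.IsLocallyLipschitz c)
    (hgrowth : ∃ C : ℝ, ∀ x : EuclideanSpace ℝ (Fin d),
      2 * inner ℝ x (f₀ x) + ‖f x‖ ^ 2 ≤ C * (1 + ‖x‖ ^ 2)) :
    (∀ u : SigApprox.Control m T, ∃ x : ℝ → EuclideanSpace ℝ (Fin d),
      SigApprox.IsSolution T f₀ f x₀ u x ∧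
      ∀ z : ℝ → EuclideanSpace ℝ (Fin d),
        SigApprox.IsSolution T f₀ f x₀ u z → EqOn z x (Icc 0 T)) ∧
    ∀ x : SigApprox.Control m T → ℝ → EuclideanSpace ℝ (Fin d),
      (∀ u : SigApprox.Control m T, SigApprox.IsSolution T f₀ f x₀ u (x u)) →
      ∀ K : Set (SigApprox.Control m T), IsCompact K →
      ∀ i : Fin p, ∀ ε : ℝ, 0 < ε →
        ∃ l : SigApprox.Weights (m + 1),
          (⨆ t ∈ Icc (0 : ℝ) T, ⨆ u ∈ K,
            ENNReal.ofReal |c (x u t) i -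
              SigApprox.pairing l
                (SigApprox.signature (SigApprox.timeExtended (u : ℝ → EuclideanSpace ℝ (Fin m)))
                  0 t)|) <
            ENNReal.ofReal ε := by
  open SigApprox in
  -- Grönwall needs a nonnegative kernel, so `C` is replaced by `|C|`.
  obtain ⟨C, hC, hC0⟩ : ∃ C : ℝ, (∀ x : EuclideanSpace ℝ (Fin d),
      2 * inner ℝ x (f₀ x) + ‖f x‖ ^ 2 ≤ C * (1 + ‖x‖ ^ 2)) ∧ 0 ≤ C := by
    obtain ⟨C, hC⟩ := hgrowth
    exact ⟨|C|, fun x => (hC x).trans (by gcongr; exact le_abs_self C), abs_nonneg C⟩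
  refine ⟨fun u => ?_, fun x hx K hK i ε hε => ?_⟩
  · obtain ⟨x, hx⟩ := exists_isSolution hT.le hC0 hf₀ hf hC u.integrableOn
      u.integrableOn_norm_sq x₀
    exact ⟨x, hx, fun z hz => hz.eqOn hT.le hf₀ hf hx u.integrableOn u.integrableOn
      (Filter.Eventually.of_forall fun _ _ => rfl)⟩
  have hcK : CompactSpace K := isCompact_iff_compactSpace.1 hK
  have hU : ∀ u : K,
      IntegrableOn ((u : Control m T) : ℝ → EuclideanSpace ℝ (Fin m)) (Icc 0 T) :=
    fun u => (u : Control m T).integrableOn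
  have hyc : Continuous fun q : Icc (0 : ℝ) T × K => c (x q.2 q.1) i :=
    (EuclideanSpace.proj i : EuclideanSpace ℝ (Fin p) →L[ℝ] ℝ).continuous.comp
      (hc.continuous.comp (continuous_solution hT.le hC0 hf₀ hf hC hx hK.isBounded))
  obtain ⟨g, ⟨F, ⟨l, hl⟩, hgF⟩, hg⟩ := exists_mem_subalgebra_norm_sub_lt
    (signatureSubalgebra hT.le K) ⟨_, hyc⟩ (by
      rintro ⟨t, u⟩ ⟨t', v⟩ hab
      have htime : t = t' := Subtype.ext (hab
        ⟨fun q => (q.1 : ℝ), continuous_subtype_val.comp continuous_fst⟩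
        ⟨_, isSignatureFunctional_time hT.le hU, fun _ => rfl⟩)
      subst htime
      have hmom : ∀ (n : ℕ) (j : Fin m),
          ∫ s in (0 : ℝ)..t, s ^ n * ((u : Control m T) : ℝ → EuclideanSpace ℝ (Fin m)) s j =
            ∫ s in (0 : ℝ)..t, s ^ n * ((v : Control m T) : ℝ → EuclideanSpace ℝ (Fin m)) s j :=
        fun n j => hab ⟨_, continuous_moment hT.le K n j⟩
          ⟨_, isSignatureFunctional_moment hT.le hU n j, fun _ => rfl⟩
      have hsub : Icc (0 : ℝ) t ⊆ Icc 0 T := Icc_subset_Icc_right t.2.2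
      have hut := (hU u).mono_set hsub
      have hvt := (hU v).mono_set hsub
      -- The two controls are known to agree only before `t`, so both solutions are restricted to
      -- $[0,t]$ before uniqueness is applied.
      have := ((hx u).mono t.2.2).eqOn t.2.1 hf₀ hf ((hx v).mono t.2.2) hut hvt
        (ae_eq_of_moments_eq t.2.1 hut hvt hmom) ⟨t.2.1, le_rfl⟩
      simp only [ContinuousMap.coe_mk]
      rw [this]) (half_pos hε)
  -- Passing to the supremum loses strictness; the approximation within `ε / 2` restores it.
  refine ⟨l, lt_of_le_of_lt (iSup₂_le fun t ht => iSup₂_le fun u hu => ?_)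
    ((ENNReal.ofReal_lt_ofReal_iff hε).2 (half_lt_self hε))⟩
  refine ENNReal.ofReal_le_ofReal ?_
  have h1 := hg (⟨t, ht⟩, ⟨u, hu⟩)
  rw [hgF, hl ⟨u, hu⟩ t ht, abs_sub_comm] at h1
  exact h1.le
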